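/- Let $R=(a_1,b_1)\times(a_2,b_2)\subset\mathbb R^2$ be a bounded open rectangle, and let $L^2_0(R)=\{f\in L^2(R):\int_R f\,dx=0\}$. The Neumann Laplacian $-\Delta_N$ is the self-adjoint operator on $L^2(R)$ associated with the quadratic form $\int_R|\nabla u|^2\,dx$ on $H^1(R)$; thus $\psi\ne 0$ is an eigenfunction with eigenvalue $\lambda$ iff $\psi\in H^1(R)$ and $\int_R\nabla\psi\cdot\nabla v\,dx=\lambda\int_R\psi v\,dx$ for all $v\in H^1(R)$. Then $L^2(R)$ has a complete orthonormal basis $(\psi_k)_{k\ge0}$ of eigenfunctions of $-\Delta_N$ whose eigenvalues satisfy $0=\lambda_0<\lambda_1\le\lambda_2\le\cdots$. Fix any such eigenpairs $(\lambda_k,\psi_k)_{k\ge0}$. Let $\rho$ be a function on $R$ and $\bar\rho$ a constant such that the residual density $r=\rho-\bar\rho$ belongs to $L^2_0(R)$. (This holds in particular for a floorplan: if $M_1,\dots,M_n\subset\overline R$ are closed axis-parallel rectangles of areas $A_1,\dots,A_n$, which may overlap, one takes $\rho=\sum_{i=1}^n \mathbf 1_{M_i}$ and $\bar\rho=\frac1{|R|}\sum_{i=1}^n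 A_i$.) Put $\mathrm{Var}(\rho)=\int_R(\rho-\bar\rho)^2\,dx$ and $\alpha_k=\int_R r\,\psi_k\,dx$. Then: 1. $\alpha_0=0$ and $r=\sum_{k\ge1}\alpha_k\psi_k$ in $L^2(R)$. 2. $\mathrm{Var}(\rho)=\sum_{k\ge1}\alpha_k^2$. 3. There is a unique $\phi\in H^1(R)$ with $\int_R\phi\,dx=0$ that solves weakly $-\Delta\phi=r$ in $R$, $\nabla\phi\cdot\mathbf n=0$ on $\partial R$, that is, $\int_R\nabla\phi\cdot\nabla v\,dx=\int_R r v\,dx$ for all $v\in H^1(R)$. The Poisson energy $E=\frac12\int_R r\,\phi\,dx$ satisfies $$E=\frac12\sum_{k\ge1}\frac{\alpha_k^2}{\lambda_k}=\frac12\int_R|\nabla\phi|^2\,dx=\frac12\,\|r\|_{H^{-1}}^2\ \ge\ 0,$$ where the series converges and $\|r\|_{H^{-1}}=\sup\{\int_R r v\,dx : v\in H^1(R),\ \|\nabla v\|_{L^2(R)}\le 1\}<\infty$ is the norm of $r$ as a functional on $H^1(R)/\mathbb R$ with the norm $\|\nabla v\|_{L^2(R)}$. -/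

import Mathlib

open MeasureTheory Set Filter
open scoped ContDiff

namespace PoissonEnergy

/-- The Euclidean plane. -/
abbrev Plane : Type := EuclideanSpace ℝ (Fin 2)

/-- A bounded, nondegenerate, axis-parallel rectangle in the plane, given by its corners. -/
structure Rect where
  lo : Fin 2 → ℝ
  hi : Fin 2 → ℝ
  lo_lt_hi : ∀ i, lo i < hi i

/-- The open rectangle. -/
def Rect.domain (R : Rect) : Set Plane := {x | ∀ i, x i ∈ Ioo (R.lo i) (R.hi i)}

/-- The closed rectangle. -/
def Rect.closedDomain (R : Rect) : Set Plane := {x | ∀ i, x i ∈ Icc (R.lo i) (R.hi i)}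

/-- `g` is a weak gradient of `u` on the open set `U`:
`∫_U u ∂ᵢη = - ∫_U gᵢ η` for all smooth `η` with compact support in `U`. -/
def IsWeakGradient (U : Set Plane) (u : Plane → ℝ) (g : Plane → Plane) : Prop :=
  ∀ η : Plane → ℝ, ContDiff ℝ ∞ η → HasCompactSupport η → tsupport η ⊆ U → ∀ i : Fin 2,
    ∫ x in U, u x * fderiv ℝ η x (EuclideanSpace.single i 1) = - ∫ x in U, g x i * η x

/-- `u` belongs to the Sobolev space `H¹(U)` and `g` is its weak gradient. -/
structure IsH1 (U : Set Plane) (u : Plane → ℝ) (g : Plane → Plane) : Prop where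
  memLp : MemLp u 2 (volume.restrict U)
  memLp_grad : MemLp g 2 (volume.restrict U)
  weakGradient : IsWeakGradient U u g

/-- `f` belongs to `L²₀(U)`, the square integrable functions of zero mean. -/
structure MemL2Zero (U : Set Plane) (f : Plane → ℝ) : Prop where
  memLp : MemLp f 2 (volume.restrict U)
  integral_eq_zero : ∫ x in U, f x = 0

/-- `φ`, with weak gradient `g`, is a zero-mean weak solution of the Neumann problem
`-Δφ = r` in `U`, `∇φ · n = 0` on `∂U`. -/
structure IsNeumannSolution (U : Set Plane) (r : Plane → ℝ) (φ : Plane → ℝ) (g : Plane → Plane) :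
    Prop where
  isH1 : IsH1 U φ g
  integral_eq_zero : ∫ x in U, φ x = 0
  weak_eq : ∀ (v : Plane → ℝ) (gv : Plane → Plane), IsH1 U v gv →
    ∫ x in U, inner ℝ (g x) (gv x) = ∫ x in U, r x * v x

/-- `ψ` is an eigenfunction, with eigenvalue `μ`, of the Neumann Laplacian on `U`, the self-adjoint
operator on `L²(U)` associated with the quadratic form `∫_U |∇u|²` on `H¹(U)`. -/
def IsNeumannEigenfunction (U : Set Plane) (μ : ℝ) (ψ : Plane → ℝ) : Prop :=
  (¬ ψ =ᵐ[volume.restrict U] 0) ∧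
  ∃ g : Plane → Plane, IsH1 U ψ g ∧
    ∀ (v : Plane → ℝ) (gv : Plane → Plane), IsH1 U v gv →
      ∫ x in U, inner ℝ (g x) (gv x) = μ * ∫ x in U, ψ x * v x

/-- `(lam k, ψ k)`, `k ≥ 0`, are the eigenpairs of the Neumann Laplacian on `U`: the `ψ k` are a
complete orthonormal basis of `L²(U)` made of eigenfunctions, and
`0 = lam 0 < lam 1 ≤ lam 2 ≤ …`. -/
structure IsNeumannEigenbasis (U : Set Plane) (lam : ℕ → ℝ)
    (ψ : HilbertBasis ℕ ℝ (Lp ℝ 2 (volume.restrict U))) : Prop where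
  lam_zero : lam 0 = 0
  lam_one_pos : 0 < lam 1
  lam_mono : Monotone lam
  eigen : ∀ k, IsNeumannEigenfunction U (lam k) (ψ k)

/-- The variance `∫_U (ρ - ρ̄)²` (not normalised by the area of `U`). -/
noncomputable def variance (U : Set Plane) (ρ : Plane → ℝ) (ρbar : ℝ) : ℝ :=
  ∫ x in U, (ρ x - ρbar) ^ 2

/-- The Poisson energy `½ ∫_U r φ`, where `φ` is the potential of the residual density `r`. -/
noncomputable def poissonEnergy (U : Set Plane) (r φ : Plane → ℝ) : ℝ :=
  1 / 2 * ∫ x in U, r x * φ x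

/-- The values `∫_U r v` of the functional `r` on the unit ball of `H¹(U)` for `‖∇v‖_{L²(U)}`. -/
def dualValues (U : Set Plane) (r : Plane → ℝ) : Set ℝ :=
  {s | ∃ (v : Plane → ℝ) (gv : Plane → Plane), IsH1 U v gv ∧
    ∫ x in U, ‖gv x‖ ^ 2 ≤ 1 ∧ s = ∫ x in U, r x * v x}

/-- The `H⁻¹` norm of `r`: its norm as a functional on `H¹(U)/ℝ` with the norm `‖∇v‖_{L²(U)}`. -/
noncomputable def hMinusOneNorm (U : Set Plane) (r : Plane → ℝ) : ℝ := sSup (dualValues U r)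

/-- The sizes (width and height) of `n` rectangular modules. -/
structure Modules (n : ℕ) where
  size : Fin n → Fin 2 → ℝ
  size_pos : ∀ i j, 0 < size i j

/-- The region occupied by the module `i` in the placement with centers `c`. -/
def Modules.region {n : ℕ} (M : Modules n) (c : Fin n → Plane) (i : Fin n) : Set Plane :=
  {x | ∀ j, |x j - c i j| ≤ M.size i j / 2}

/-- The area of the module `i`. -/
def Modules.area {n : ℕ} (M : Modules n) (i : Fin n) : ℝ := M.size i 0 * M.size i 1

/-- The aggregate density `ρ(x; c)`, the sum of the indicators of the modules. -/
noncomputable def Modules.density {n : ℕ} (M : Modules n) (c : Fin n → Plane) (x : Plane) : ℝ :=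
  ∑ i, (M.region c i).indicator (fun _ => (1 : ℝ)) x

/-- The average density: the total area of the modules divided by the area of the rectangle. -/
noncomputable def Modules.meanDensity {n : ℕ} (M : Modules n) (R : Rect) : ℝ :=
  (∑ i, M.area i) / volume.real R.domain

end PoissonEnergy

open PoissonEnergy

/-! Everything is Parseval's identity in a Neumann eigenbasis. Testing the weak eigenvalue equation
with the constant `1` shows that every `ψ (k + 1)` has zero mean. Hence a function of zero mean has
no `ψ 0` component, and its products with `L²` functions expand over `k ≥ 1` (`hasSum_inner_succ`).
Testing with `ψ l` shows that the gradients are orthogonal with squared norms `lam k`. Since `lam (k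
+ 1) ≥ lam 1 > 0`, the series with coefficients `α k / lam k` converges together with its gradients,
and its sum solves the Neumann problem. Conversely, testing with `ψ k` forces these coefficients on
any solution, which gives uniqueness and the energy series. The dual norm is `‖∇φ‖` by
Cauchy-Schwarz, with equality at the normalised `φ`.

The existence of an eigenbasis is proved by hand with products of cosines. They are eigenfunctions
against every `H¹` test function because their normal derivatives vanish on the boundary
(`integral_mul_deriv_eq`), complete by Stone-Weierstrass (`integral_mul_eq_zero_of_continuous`), and
can be listed by increasing eigenvalue because only finitely many eigenvalues lie below any bound.
-/

/-! ### Enumeration by size, and two facts on series -/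

/-- A family of reals indexed by an infinite type with finite sublevel sets can be enumerated
in nondecreasing order. -/
theorem exists_equiv_nat_monotone {ι : Type*} [Infinite ι] [Encodable ι] (w : ι → ℝ)
    (hw : ∀ c, {p | w p ≤ c}.Finite) : ∃ e : ℕ ≃ ι, Monotone (w ∘ e) := by
  -- The encoding breaks ties in `w`, so `f` is injective into a linear order.
  let f : ι → ℝ ×ₗ ℕ := fun p => toLex (w p, Encodable.encode p)
  have f_inj : Function.Injective f := fun p q h =>
    Encodable.encode_injective (congrArg (fun z => (ofLex z).2) h)
  have f_mono : ∀ p q, f p ≤ f q → w p ≤ w q := fun p q h => by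
    rcases (Prod.Lex.le_iff).1 h with h | h
    · exact le_of_lt h
    · exact le_of_eq h.1
  have hfin : ∀ p, {q | f q < f p}.Finite := fun p =>
    (hw (w p)).subset fun q hq => f_mono q p (le_of_lt hq)
  -- The rank of `p`. Surjectivity of `g` is not needed: its range is an infinite subset of `ℕ`,
  -- which has an increasing enumeration.
  let g : ι → ℕ := fun p => {q | f q < f p}.ncard
  have g_lt : ∀ p q, f p < f q → g p < g q := fun p q h =>
    Set.ncard_lt_ncard (Set.ssubset_iff_exists.2
      ⟨fun z (hz : f z < f p) => hz.trans h, p, h, fun hz : f p < f p => lt_irrefl _ hz⟩) (hfin q)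
  have g_inj : Function.Injective g := fun p q h => by
    by_contra hne
    rcases lt_or_gt_of_ne (f_inj.ne hne) with h' | h'
    · exact (g_lt _ _ h').ne h
    · exact (g_lt _ _ h').ne' h
  have : Infinite (range g) := (Set.infinite_range_of_injective g_inj).to_subtype
  let o := Nat.Subtype.orderIsoOfNat (range g)
  let e : ι ≃ range g := Equiv.ofInjective g g_inj
  refine ⟨o.toEquiv.trans e.symm, fun m n hmn => ?_⟩
  have key : ∀ n, g (e.symm (o n)) = o n := fun n =>
    congrArg Subtype.val (e.apply_symm_apply (o n))
  refine f_mono _ _ (not_lt.1 fun hlt => ?_)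
  have h1 := g_lt _ _ hlt
  simp only [Equiv.trans_apply, RelIso.coe_fn_toEquiv, key] at h1
  exact absurd (o.monotone hmn) (not_le.2 h1)

theorem HasSum.comp_succ_of_eq_zero {E : Type*} [AddCommGroup E] [TopologicalSpace E]
    [IsTopologicalAddGroup E] {f : ℕ → E} {a : E} (h : HasSum f a) (h0 : f 0 = 0) :
    HasSum (fun k => f (k + 1)) a := by
  rw [hasSum_nat_add_iff 1]
  simpa [h0] using h

theorem Orthonormal.summable_smul {ι E : Type*} [NormedAddCommGroup E] [InnerProductSpace ℝ E]
    [CompleteSpace E] {v : ι → E} (hv : Orthonormal ℝ v) {c : ι → ℝ}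
    (hc : Summable fun k => c k ^ 2) : Summable fun k => c k • v k := by
  have := (hv.orthogonalFamily.summable_iff_norm_sq_summable c).2 (by simpa using hc)
  simpa using this

/-! ### Measure and topology of rectangles -/

namespace PoissonEnergy

namespace Rect

variable (R : Rect)

theorem isOpen_domain : IsOpen R.domain := by
  have : R.domain = ⋂ i, (fun x : Plane => x i) ⁻¹' Ioo (R.lo i) (R.hi i) := by
    ext x; simp [domain]
  rw [this]
  exact isOpen_iInter_of_finite fun i => isOpen_Ioo.preimage (by fun_prop)

theorem measurableSet_domain : MeasurableSet R.domain := R.isOpen_domain.measurableSet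

theorem isCompact_closedDomain : IsCompact R.closedDomain := by
  have : R.closedDomain = (EuclideanSpace.equiv (Fin 2) ℝ).toHomeomorph ⁻¹'
      (univ.pi fun i => Icc (R.lo i) (R.hi i)) := by
    ext x
    simp [closedDomain, -pi_univ_Icc]
  rw [this, Homeomorph.isCompact_preimage]
  exact isCompact_univ_pi fun i => isCompact_Icc

theorem domain_subset_closedDomain : R.domain ⊆ R.closedDomain :=
  fun _ hx i => Ioo_subset_Icc_self (hx i)

theorem domain_eq_preimage :
    R.domain = WithLp.ofLp ⁻¹' (univ.pi fun i => Ioo (R.lo i) (R.hi i)) := by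
  ext x; simp [domain]

instance : IsFiniteMeasure (volume.restrict R.domain) :=
  ⟨by
    rw [Measure.restrict_apply_univ]
    exact (measure_mono R.domain_subset_closedDomain).trans_lt
      R.isCompact_closedDomain.measure_lt_top⟩

theorem measurePreserving_ofLp :
    MeasurePreserving (WithLp.ofLp : Plane → Fin 2 → ℝ) (volume.restrict R.domain)
      (Measure.pi fun i => volume.restrict (Ioo (R.lo i) (R.hi i))) := by
  have := (PiLp.volume_preserving_ofLp (Fin 2)).restrict_preimage
    (s := univ.pi fun i => Ioo (R.lo i) (R.hi i)) (MeasurableSet.univ_pi fun i => measurableSet_Ioo)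
  rw [← R.domain_eq_preimage, volume_pi, Measure.restrict_pi_pi] at this
  exact this

theorem setIntegral_prod (f : Fin 2 → ℝ → ℝ) :
    ∫ x in R.domain, ∏ i, f i (x i) = ∏ i, ∫ t in R.lo i..R.hi i, f i t := by
  have h := R.measurePreserving_ofLp.integral_comp
    (MeasurableEquiv.toLp 2 (Fin 2 → ℝ)).symm.measurableEmbedding (fun y => ∏ i, f i (y i))
  rw [h, integral_fintype_prod_eq_prod]
  refine Finset.prod_congr rfl fun i _ => ?_
  rw [intervalIntegral.integral_of_le (R.lo_lt_hi i).le, integral_Ioc_eq_integral_Ioo]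

theorem volume_closedDomain : volume R.closedDomain = ∏ i, ENNReal.ofReal (R.hi i - R.lo i) := by
  have h : R.closedDomain = WithLp.ofLp ⁻¹' (univ.pi fun i => Icc (R.lo i) (R.hi i)) := by
    ext x; simp [closedDomain, -pi_univ_Icc]
  rw [h, (PiLp.volume_preserving_ofLp (Fin 2)).measure_preimage
    (MeasurableSet.univ_pi fun i => measurableSet_Icc).nullMeasurableSet, volume_pi_pi]
  simp

theorem volume_domain : volume R.domain = ∏ i, ENNReal.ofReal (R.hi i - R.lo i) := by
  rw [domain_eq_preimage, (PiLp.volume_preserving_ofLp (Fin 2)).measure_preimage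
    (MeasurableSet.univ_pi fun i => measurableSet_Ioo).nullMeasurableSet, volume_pi_pi]
  simp

theorem volume_real_domain_pos : 0 < volume.real R.domain := by
  rw [Measure.real, volume_domain, ENNReal.toReal_prod]
  exact Finset.prod_pos fun i _ => by
    rw [ENNReal.toReal_ofReal (sub_nonneg.2 (R.lo_lt_hi i).le)]
    exact sub_pos.2 (R.lo_lt_hi i)

/-- Equal finite volumes make the boundary null; modules lie in the closed rectangle, whereas
integrals run over the open one. -/
theorem domain_ae_eq_closedDomain : R.domain =ᵐ[volume] R.closedDomain :=
  ae_eq_of_subset_of_measure_ge R.domain_subset_closedDomain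
    (by rw [volume_domain, volume_closedDomain]) R.measurableSet_domain.nullMeasurableSet
    R.isCompact_closedDomain.measure_lt_top.ne

end Rect

/-! ### Floorplans -/

namespace Modules

variable {n : ℕ} (M : Modules n)

/-- The region of a module as a closed rectangle. -/
noncomputable def rect (c : Fin n → Plane) (i : Fin n) : Rect where
  lo j := c i j - M.size i j / 2
  hi j := c i j + M.size i j / 2
  lo_lt_hi j := by linarith [M.size_pos i j]

theorem region_eq (c : Fin n → Plane) (i : Fin n) :
    M.region c i = (M.rect c i).closedDomain := by
  ext x
  refine forall_congr' fun j => ?_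
  simp only [rect, mem_Icc, abs_le]
  constructor <;> rintro ⟨h1, h2⟩ <;> constructor <;> linarith

theorem measurableSet_region (c : Fin n → Plane) (i : Fin n) : MeasurableSet (M.region c i) := by
  rw [region_eq]
  exact (M.rect c i).isCompact_closedDomain.measurableSet

theorem volume_real_region (c : Fin n → Plane) (i : Fin n) :
    volume.real (M.region c i) = M.area i := by
  rw [region_eq, Measure.real, Rect.volume_closedDomain, ENNReal.toReal_prod, Fin.prod_univ_two]
  simp only [rect, area]
  rw [ENNReal.toReal_ofReal (by linarith [M.size_pos i 0]),
    ENNReal.toReal_ofReal (by linarith [M.size_pos i 1])]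
  ring

/-- Overlaps are harmless: the integral of a sum of indicators is the sum of the areas. -/
theorem memL2Zero_density_sub (R : Rect) (c : Fin n → Plane)
    (hc : ∀ i, M.region c i ⊆ R.closedDomain) :
    MemL2Zero R.domain (fun x => M.density c x - M.meanDensity R) := by
  have hL (i : Fin n) {p : ENNReal} : MemLp ((M.region c i).indicator fun _ => (1 : ℝ)) p
      (volume.restrict R.domain) := (memLp_const 1).indicator (M.measurableSet_region c i)
  have hd {p : ENNReal} : MemLp (M.density c) p (volume.restrict R.domain) :=
    memLp_finsetSum _ fun i _ => hL i
  refine ⟨hd.sub (memLp_const _), ?_⟩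
  rw [integral_sub (memLp_one_iff_integrable.1 hd) (integrable_const _)]
  have h1 : ∫ x in R.domain, M.density c x = ∑ i, M.area i := by
    unfold density
    rw [integral_finsetSum _ fun i _ => memLp_one_iff_integrable.1 (hL i)]
    refine Finset.sum_congr rfl fun i _ => ?_
    rw [integral_indicator_const _ (M.measurableSet_region c i), smul_eq_mul, mul_one,
      Measure.restrict_congr_set R.domain_ae_eq_closedDomain,
      measureReal_restrict_apply (M.measurableSet_region c i), inter_eq_left.2 (hc i),
      volume_real_region]
  rw [h1, setIntegral_const, smul_eq_mul, meanDensity,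
    mul_div_cancel₀ _ R.volume_real_domain_pos.ne', sub_self]

end Modules

/-! ### Cutoffs and their derivatives -/

open scoped Topology

/-- A smooth cutoff function, compactly supported in `Ioo a b`, which tends to `1` there. -/
noncomputable def cutoff (a b : ℝ) (n : ℕ) (t : ℝ) : ℝ :=
  Real.smoothTransition (n * ((t - a) * (b - t)) - 1)

theorem contDiff_cutoff (a b : ℝ) (n : ℕ) : ContDiff ℝ ∞ (cutoff a b n) :=
  Real.smoothTransition.contDiff.comp (by fun_prop)

theorem abs_cutoff_le_one (a b : ℝ) (n : ℕ) (t : ℝ) : |cutoff a b n t| ≤ 1 := by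
  rw [cutoff, abs_of_nonneg (Real.smoothTransition.nonneg _)]
  exact Real.smoothTransition.le_one _

theorem tsupport_cutoff_subset {a b : ℝ} (hab : a < b) (n : ℕ) :
    tsupport (cutoff a b n) ⊆ Ioo a b := by
  have hcl : IsClosed {t : ℝ | 1 ≤ n * ((t - a) * (b - t))} :=
    isClosed_le continuous_const (by fun_prop)
  have hsub : tsupport (cutoff a b n) ⊆ {t : ℝ | 1 ≤ n * ((t - a) * (b - t))} := by
    refine closure_minimal (fun t ht => ?_) hcl
    by_contra h
    simp only [mem_ofPred_eq, not_le] at h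
    exact ht (Real.smoothTransition.zero_of_nonpos (by linarith))
  intro t ht
  have h1 : 1 ≤ n * ((t - a) * (b - t)) := hsub ht
  have h2 : 0 < (t - a) * (b - t) := by
    by_contra h
    have := mul_nonpos_of_nonneg_of_nonpos (Nat.cast_nonneg (α := ℝ) n) (not_lt.1 h)
    linarith
  constructor
  · by_contra h
    nlinarith
  · by_contra h
    nlinarith

theorem cutoff_eventually_eq_one {a b t : ℝ} (ht : t ∈ Ioo a b) :
    ∀ᶠ n in atTop, cutoff a b n =ᶠ[𝓝 t] 1 := by
  have hw : 0 < (t - a) * (b - t) := mul_pos (sub_pos.2 ht.1) (sub_pos.2 ht.2)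
  obtain ⟨N, hN⟩ := exists_nat_gt (2 / ((t - a) * (b - t)))
  filter_upwards [eventually_ge_atTop N] with n hn
  have h2 : 2 < n * ((t - a) * (b - t)) := by
    rw [div_lt_iff₀ hw] at hN
    have : (N : ℝ) ≤ n := by exact_mod_cast hn
    nlinarith
  have hc : ContinuousAt (fun t : ℝ => n * ((t - a) * (b - t))) t := by fun_prop
  filter_upwards [hc.eventually (lt_mem_nhds h2)] with s hs
  exact Real.smoothTransition.one_of_one_le (by linarith)

theorem deriv_smoothTransition_of_one_lt {t : ℝ} (ht : 1 < t) :
    deriv Real.smoothTransition t = 0 := by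
  have : Real.smoothTransition =ᶠ[𝓝 t] fun _ => 1 := by
    filter_upwards [lt_mem_nhds ht] with s hs
    exact Real.smoothTransition.one_of_one_le hs.le
  rw [this.deriv_eq, deriv_const]

theorem deriv_smoothTransition_of_neg {t : ℝ} (ht : t < 0) :
    deriv Real.smoothTransition t = 0 := by
  have : Real.smoothTransition =ᶠ[𝓝 t] fun _ => 0 := by
    filter_upwards [gt_mem_nhds ht] with s hs
    exact Real.smoothTransition.zero_of_nonpos hs.le
  rw [this.deriv_eq, deriv_const]

theorem exists_abs_deriv_smoothTransition_le :
    ∃ K, 0 ≤ K ∧ ∀ t, |deriv Real.smoothTransition t| ≤ K := by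
  have hc : Continuous (deriv Real.smoothTransition) :=
    (Real.smoothTransition.contDiff (n := 1)).continuous_deriv le_rfl
  obtain ⟨K, hK⟩ := isCompact_Icc.exists_bound_of_continuousOn (s := Icc (0 : ℝ) 1) hc.continuousOn
  have hK0 : 0 ≤ K := (norm_nonneg _).trans (hK 0 (by simp))
  refine ⟨K, hK0, fun t => ?_⟩
  by_cases h0 : t < 0
  · rw [deriv_smoothTransition_of_neg h0, abs_zero]; exact hK0
  by_cases h1 : 1 < t
  · rw [deriv_smoothTransition_of_one_lt h1, abs_zero]; exact hK0
  exact hK t ⟨not_lt.1 h0, not_lt.1 h1⟩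

theorem deriv_cutoff (a b : ℝ) (n : ℕ) (t : ℝ) : deriv (cutoff a b n) t =
    deriv Real.smoothTransition (n * ((t - a) * (b - t)) - 1) * (n * (a + b - 2 * t)) := by
  have h1 : HasDerivAt (fun t : ℝ => n * ((t - a) * (b - t)) - 1) (n * (a + b - 2 * t)) t := by
    have := ((((hasDerivAt_id t).sub_const a).mul ((hasDerivAt_id t).const_sub b)).const_mul
      (n : ℝ)).sub_const 1
    refine this.congr_deriv ?_
    simp only [id]
    ring
  have h2 : DifferentiableAt ℝ Real.smoothTransition (n * ((t - a) * (b - t)) - 1) :=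
    (Real.smoothTransition.contDiff (n := 1)).differentiable one_ne_zero _
  exact (h2.hasDerivAt.comp t h1).deriv

/-- A function vanishing at both ends of an interval is dominated there by the product of the
distances to the ends. -/
theorem exists_abs_le_mul_of_eq_zero {a b : ℝ} (hab : a < b) {f : ℝ → ℝ} (hf : ContDiff ℝ ∞ f)
    (ha : f a = 0) (hb : f b = 0) :
    ∃ M, 0 ≤ M ∧ ∀ t ∈ Ioo a b, |f t| ≤ M * ((t - a) * (b - t)) := by
  have hd : Differentiable ℝ f := hf.differentiable (by simp)
  obtain ⟨M, hM⟩ := isCompact_Icc.exists_bound_of_continuousOn (s := Icc a b)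
    (hf.continuous_deriv (by simp)).continuousOn
  have hM0 : 0 ≤ M := (norm_nonneg _).trans (hM a ⟨le_rfl, hab.le⟩)
  have hlip : ∀ x ∈ Icc a b, ∀ y ∈ Icc a b, |f y - f x| ≤ M * |y - x| := fun x hx y hy =>
    (convex_Icc a b).norm_image_sub_le_of_norm_deriv_le (fun z _ => hd z) hM hx hy
  have hL : 0 < b - a := sub_pos.2 hab
  -- The mean value bounds `|f t| ≤ M (t - a)` and `|f t| ≤ M (b - t)`, multiplied by `b - t` and `t
  -- - a` and added, give `|f t| (b - a) ≤ 2 M (t - a) (b - t)`.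
  refine ⟨2 * M / (b - a), by positivity, fun t ht => ?_⟩
  have ht' := Ioo_subset_Icc_self ht
  have h1 := hlip a ⟨le_rfl, hab.le⟩ t ht'
  have h2 := hlip b ⟨hab.le, le_rfl⟩ t ht'
  rw [ha, sub_zero, abs_of_pos (sub_pos.2 ht.1)] at h1
  rw [hb, sub_zero, abs_of_neg (sub_neg.2 ht.2)] at h2
  rw [div_mul_eq_mul_div, le_div_iff₀ hL]
  have h3 := mul_le_mul_of_nonneg_right h1 (sub_pos.2 ht.2).le
  have h4 := mul_le_mul_of_nonneg_right h2 (sub_pos.2 ht.1).le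
  nlinarith

/-- The derivative of the cutoff may grow like `n`, but it vanishes unless `n (t - a) (b - t) ≤ 2`,
and there `|f t| ≤ M (t - a) (b - t)` absorbs the factor `n`. This uniform bound is what permits
dominated convergence. -/
theorem exists_abs_deriv_cutoff_mul_le {a b : ℝ} (hab : a < b) {f : ℝ → ℝ} (hf : ContDiff ℝ ∞ f)
    (ha : f a = 0) (hb : f b = 0) :
    ∃ C, ∀ n, ∀ t ∈ Ioo a b, |deriv (fun t => cutoff a b n t * f t) t| ≤ C := by
  obtain ⟨M, hM0, hM⟩ := exists_abs_le_mul_of_eq_zero hab hf ha hb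
  obtain ⟨K, hK0, hK⟩ := exists_abs_deriv_smoothTransition_le
  obtain ⟨D, hD⟩ := isCompact_Icc.exists_bound_of_continuousOn (s := Icc a b)
    (hf.continuous_deriv (by simp)).continuousOn
  refine ⟨2 * M * K * (b - a) + D, fun n t ht => ?_⟩
  have hd : deriv (fun t => cutoff a b n t * f t) t
      = deriv (cutoff a b n) t * f t + cutoff a b n t * deriv f t :=
    (((contDiff_cutoff a b n).differentiable (by simp) t).hasDerivAt.mul
      (hf.differentiable (by simp) t).hasDerivAt).deriv
  have hD0 := hD t (Ioo_subset_Icc_self ht)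
  have h1 : |cutoff a b n t * deriv f t| ≤ D := by
    rw [abs_mul]
    exact (mul_le_of_le_one_left (abs_nonneg _) (abs_cutoff_le_one a b n t)).trans hD0
  have h2 : |deriv (cutoff a b n) t * f t| ≤ 2 * M * K * (b - a) := by
    have hL : 0 < b - a := sub_pos.2 hab
    rw [deriv_cutoff]
    by_cases h : 1 < n * ((t - a) * (b - t)) - 1
    · rw [deriv_smoothTransition_of_one_lt h]
      simp only [zero_mul, abs_zero]
      positivity
    · have hw : n * ((t - a) * (b - t)) ≤ 2 := by linarith
      have hm : |a + b - 2 * t| ≤ b - a := by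
        rw [abs_le]; constructor <;> linarith [ht.1, ht.2]
      rw [abs_mul, abs_mul, abs_mul, Nat.abs_cast]
      calc |deriv Real.smoothTransition (n * ((t - a) * (b - t)) - 1)|
              * (n * |a + b - 2 * t|) * |f t|
          ≤ K * (n * (b - a)) * (M * ((t - a) * (b - t))) := by
            gcongr
            · exact hK _
            · exact hM t ht
        _ = M * K * (b - a) * (n * ((t - a) * (b - t))) := by ring
        _ ≤ M * K * (b - a) * 2 := by gcongr
        _ = _ := by ring
  rw [hd]
  exact (abs_add_le _ _).trans (add_le_add h2 h1)

/-! ### Product test functions and integration by parts up to the boundary -/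

theorem hasFDerivAt_coord_mul_coord {f k : ℝ → ℝ} (hf : Differentiable ℝ f)
    (hk : Differentiable ℝ k) (i j : Fin 2) (x : Plane) :
    HasFDerivAt (fun x : Plane => f (x i) * k (x j))
      (f (x i) • (deriv k (x j) • (EuclideanSpace.proj j : Plane →L[ℝ] ℝ)) +
        k (x j) • (deriv f (x i) • (EuclideanSpace.proj i : Plane →L[ℝ] ℝ))) x := by
  have hi := (EuclideanSpace.proj i : Plane →L[ℝ] ℝ).hasFDerivAt (x := x)
  have hj := (EuclideanSpace.proj j : Plane →L[ℝ] ℝ).hasFDerivAt (x := x)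
  exact ((hf (x i)).hasDerivAt.comp_hasFDerivAt x hi).mul
    ((hk (x j)).hasDerivAt.comp_hasFDerivAt x hj)

theorem fderiv_coord_mul_coord {f k : ℝ → ℝ} (hf : Differentiable ℝ f)
    (hk : Differentiable ℝ k) {i j : Fin 2} (hij : i ≠ j) (x : Plane) :
    fderiv ℝ (fun x : Plane => f (x i) * k (x j)) x (EuclideanSpace.single i 1)
      = deriv f (x i) * k (x j) := by
  rw [(hasFDerivAt_coord_mul_coord hf hk i j x).fderiv]
  simp [hij.symm, mul_comm]

theorem contDiff_coord_mul_coord {f k : ℝ → ℝ} (hf : ContDiff ℝ ∞ f)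
    (hk : ContDiff ℝ ∞ k) (i j : Fin 2) :
    ContDiff ℝ ∞ (fun x : Plane => f (x i) * k (x j)) :=
  (hf.comp (EuclideanSpace.proj i : Plane →L[ℝ] ℝ).contDiff).mul
    (hk.comp (EuclideanSpace.proj j : Plane →L[ℝ] ℝ).contDiff)

theorem tsupport_coord_mul_coord_subset (R : Rect) {f k : ℝ → ℝ} {i j : Fin 2} (hij : i ≠ j)
    (hf : tsupport f ⊆ Ioo (R.lo i) (R.hi i)) (hk : tsupport k ⊆ Ioo (R.lo j) (R.hi j)) :
    tsupport (fun x : Plane => f (x i) * k (x j)) ⊆ R.domain := by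
  have hcl : IsClosed {x : Plane | x i ∈ tsupport f ∧ x j ∈ tsupport k} :=
    ((isClosed_tsupport f).preimage (by fun_prop)).inter
      ((isClosed_tsupport k).preimage (by fun_prop))
  have hsub : tsupport (fun x : Plane => f (x i) * k (x j)) ⊆
      {x : Plane | x i ∈ tsupport f ∧ x j ∈ tsupport k} :=
    closure_minimal (fun x hx => ⟨subset_tsupport _ (left_ne_zero_of_mul hx),
      subset_tsupport _ (right_ne_zero_of_mul hx)⟩) hcl
  intro x hx l
  have := hsub hx
  rcases (by omega : l = i ∨ l = j) with rfl | rfl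
  · exact hf this.1
  · exact hk this.2

theorem hasCompactSupport_of_tsupport_subset (R : Rect) {f : Plane → ℝ}
    (hf : tsupport f ⊆ R.domain) : HasCompactSupport f :=
  R.isCompact_closedDomain.of_isClosed_subset (isClosed_tsupport f)
    (hf.trans R.domain_subset_closedDomain)

namespace IsH1

variable {R : Rect} {v : Plane → ℝ} {gv : Plane → Plane}

theorem memLp_grad_apply {U : Set Plane} (h : IsH1 U v gv) (i : Fin 2) :
    MemLp (fun x => gv x i) 2 (volume.restrict U) :=
  (EuclideanSpace.proj i : Plane →L[ℝ] ℝ).comp_memLp' h.memLp_grad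

/-- Integration by parts in the direction `i` against a product function whose factor in that
direction vanishes on the boundary. -/
theorem integral_mul_deriv_eq (h : IsH1 R.domain v gv) {i j : Fin 2} (hij : i ≠ j)
    {f k : ℝ → ℝ} (hf : ContDiff ℝ ∞ f) (hk : ContDiff ℝ ∞ k) (hlo : f (R.lo i) = 0)
    (hhi : f (R.hi i) = 0) :
    ∫ x in R.domain, v x * (deriv f (x i) * k (x j))
      = - ∫ x in R.domain, gv x i * (f (x i) * k (x j)) := by
  -- Both factors are cut off to obtain admissible test functions. Only the factor in direction `i`
  -- is differentiated, so `k` needs no boundary condition.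
  set A : ℕ → ℝ → ℝ := fun n t => cutoff (R.lo i) (R.hi i) n t * f t with hA
  set B : ℕ → ℝ → ℝ := fun n t => cutoff (R.lo j) (R.hi j) n t * k t with hB
  have hAs n : ContDiff ℝ ∞ (A n) := (contDiff_cutoff _ _ n).mul hf
  have hBs n : ContDiff ℝ ∞ (B n) := (contDiff_cutoff _ _ n).mul hk
  have hAd n : Differentiable ℝ (A n) := (hAs n).differentiable (by simp)
  have hBd n : Differentiable ℝ (B n) := (hBs n).differentiable (by simp)
  have htest n : ∫ x in R.domain, v x * (deriv (A n) (x i) * B n (x j))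
      = - ∫ x in R.domain, gv x i * (A n (x i) * B n (x j)) := by
    have hs := tsupport_coord_mul_coord_subset R hij
      ((tsupport_mul_subset_left (g := f)).trans (tsupport_cutoff_subset (R.lo_lt_hi i) n))
      ((tsupport_mul_subset_left (g := k)).trans (tsupport_cutoff_subset (R.lo_lt_hi j) n))
    have := h.weakGradient (fun x => A n (x i) * B n (x j))
      (contDiff_coord_mul_coord (hAs n) (hBs n) i j)
      (hasCompactSupport_of_tsupport_subset R hs) hs i
    simpa only [fderiv_coord_mul_coord (hAd n) (hBd n) hij] using this
  obtain ⟨C, hC⟩ := exists_abs_deriv_cutoff_mul_le (R.lo_lt_hi i) hf hlo hhi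
  obtain ⟨F, hF⟩ := isCompact_Icc.exists_bound_of_continuousOn (s := Icc (R.lo i) (R.hi i))
    hf.continuous.continuousOn
  obtain ⟨K, hK⟩ := isCompact_Icc.exists_bound_of_continuousOn (s := Icc (R.lo j) (R.hi j))
    hk.continuous.continuousOn
  have hAF n : ∀ t ∈ Ioo (R.lo i) (R.hi i), |A n t| ≤ F := fun t ht => by
    rw [hA, abs_mul]
    exact (mul_le_of_le_one_left (abs_nonneg _) (abs_cutoff_le_one _ _ n t)).trans
      (hF t (Ioo_subset_Icc_self ht))
  have hBK n : ∀ t ∈ Ioo (R.lo j) (R.hi j), |B n t| ≤ K := fun t ht => by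
    rw [hB, abs_mul]
    exact (mul_le_of_le_one_left (abs_nonneg _) (abs_cutoff_le_one _ _ n t)).trans
      (hK t (Ioo_subset_Icc_self ht))
  have hAlim : ∀ t ∈ Ioo (R.lo i) (R.hi i), ∀ᶠ n in atTop, A n =ᶠ[𝓝 t] f := fun t ht => by
    filter_upwards [cutoff_eventually_eq_one ht] with n hn
    filter_upwards [hn] with s hs
    simp [hA, hs]
  have hBlim : ∀ t ∈ Ioo (R.lo j) (R.hi j), ∀ᶠ n in atTop, B n t = k t := fun t ht => by
    filter_upwards [cutoff_eventually_eq_one ht] with n hn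
    simp [hB, hn.self_of_nhds]
  have hproj (l : Fin 2) : Continuous fun x : Plane => x l := by fun_prop
  -- At each interior point the integrand is eventually constant in `n`, because the cutoffs equal
  -- `1` in a neighbourhood.
  have lim1 : Tendsto (fun n => ∫ x in R.domain, v x * (deriv (A n) (x i) * B n (x j))) atTop
      (𝓝 (∫ x in R.domain, v x * (deriv f (x i) * k (x j)))) := by
    refine tendsto_integral_of_dominated_convergence (fun x => |v x| * (C * K)) (fun n => ?_)
      ((h.memLp.integrable one_le_two).abs.mul_const _) (fun n => ?_) ?_
    · exact h.memLp.aestronglyMeasurable.mul (Continuous.aestronglyMeasurable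
        ((((hAs n).continuous_deriv (by simp)).comp (hproj i)).mul
          ((hBs n).continuous.comp (hproj j))))
    · filter_upwards [ae_restrict_mem R.measurableSet_domain] with x hx
      have hpos : 0 ≤ C := (abs_nonneg _).trans (hC n _ (hx i))
      rw [norm_mul, norm_mul, ← Real.norm_eq_abs]
      gcongr
      · exact hC n _ (hx i)
      · exact hBK n _ (hx j)
    · filter_upwards [ae_restrict_mem R.measurableSet_domain] with x hx
      refine tendsto_const_nhds.congr' ?_
      filter_upwards [hAlim _ (hx i), hBlim _ (hx j)] with n h1 h2
      rw [h1.deriv_eq, h2]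
  have lim2 : Tendsto (fun n => ∫ x in R.domain, gv x i * (A n (x i) * B n (x j))) atTop
      (𝓝 (∫ x in R.domain, gv x i * (f (x i) * k (x j)))) := by
    refine tendsto_integral_of_dominated_convergence (fun x => |gv x i| * (F * K)) (fun n => ?_)
      (((h.memLp_grad_apply i).integrable one_le_two).abs.mul_const _) (fun n => ?_) ?_
    · exact (h.memLp_grad_apply i).aestronglyMeasurable.mul (Continuous.aestronglyMeasurable
        (((hAs n).continuous.comp (hproj i)).mul ((hBs n).continuous.comp (hproj j))))
    · filter_upwards [ae_restrict_mem R.measurableSet_domain] with x hx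
      have hpos : 0 ≤ F := (abs_nonneg _).trans (hAF n _ (hx i))
      rw [norm_mul, norm_mul, ← Real.norm_eq_abs]
      gcongr
      · exact hAF n _ (hx i)
      · exact hBK n _ (hx j)
    · filter_upwards [ae_restrict_mem R.measurableSet_domain] with x hx
      refine tendsto_const_nhds.congr' ?_
      filter_upwards [hAlim _ (hx i), hBlim _ (hx j)] with n h1 h2
      rw [h1.self_of_nhds, h2]
  refine tendsto_nhds_unique lim1 ?_
  simp only [htest]
  exact lim2.neg

end IsH1

/-! ### Smooth functions in `H¹`, and scaling and null-set changes -/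

theorem memLp_of_continuous (R : Rect) {E : Type*} [NormedAddCommGroup E]
    {f : Plane → E} (hf : Continuous f) (p : ENNReal) :
    MemLp f p (volume.restrict R.domain) := by
  obtain ⟨C, hC⟩ := R.isCompact_closedDomain.exists_bound_of_continuousOn hf.continuousOn
  refine MemLp.of_bound hf.aestronglyMeasurable C ?_
  filter_upwards [ae_restrict_mem R.measurableSet_domain] with x hx
  exact hC x (R.domain_subset_closedDomain hx)

/-- The classical gradient of a smooth function is its weak gradient. -/
theorem isH1_of_contDiff (R : Rect) {u : Plane → ℝ} (hu : ContDiff ℝ ∞ u) :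
    IsH1 R.domain u
      (fun x => WithLp.toLp 2 fun i => fderiv ℝ u x (EuclideanSpace.single i 1)) := by
  have hcont (w : Plane) {u : Plane → ℝ} (hu : ContDiff ℝ ∞ u) :
      Continuous fun x => fderiv ℝ u x w :=
    (hu.continuous_fderiv (by simp)).clm_apply continuous_const
  refine ⟨memLp_of_continuous R hu.continuous 2, memLp_of_continuous R ?_ 2, ?_⟩
  · exact (PiLp.continuous_toLp 2 _).comp (continuous_pi fun i => hcont _ hu)
  intro η hη hηc hηs i
  set w : Plane := EuclideanSpace.single i 1
  -- Since `η` vanishes near every point outside the domain, both integrals extend to the whole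
  -- plane, where no boundary term arises.
  have hz : ∀ x ∉ R.domain, η =ᶠ[𝓝 x] 0 := fun x hx =>
    notMem_tsupport_iff_eventuallyEq.1 fun h => hx (hηs h)
  rw [setIntegral_eq_integral_of_forall_compl_eq_zero fun x hx => by
      rw [(hz x hx).fderiv_eq]; simp,
    setIntegral_eq_integral_of_forall_compl_eq_zero fun x hx => by
      rw [(hz x hx).self_of_nhds]; simp]
  exact integral_mul_fderiv_eq_neg_fderiv_mul_of_integrable
    (((hcont w hu).mul hη.continuous).integrable_of_hasCompactSupport hηc.mul_left)
    ((hu.continuous.mul (hcont w hη)).integrable_of_hasCompactSupport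
      ((hηc.fderiv_apply (𝕜 := ℝ) w).mul_left))
    ((hu.continuous.mul hη.continuous).integrable_of_hasCompactSupport hηc.mul_left)
    (fun x _ => hu.differentiable (by simp) x) (fun x _ => hη.differentiable (by simp) x)

variable {U : Set Plane}

theorem IsWeakGradient.const_smul {u : Plane → ℝ} {g : Plane → Plane} (h : IsWeakGradient U u g)
    (c : ℝ) : IsWeakGradient U (c • u) (c • g) := fun η h1 h2 h3 i => by
  simp only [Pi.smul_apply, smul_eq_mul, PiLp.smul_apply, mul_assoc, integral_const_mul,
    h η h1 h2 h3 i, mul_neg]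

theorem IsH1.const_smul {u : Plane → ℝ} {g : Plane → Plane} (h : IsH1 U u g) (c : ℝ) :
    IsH1 U (c • u) (c • g) :=
  ⟨h.memLp.const_smul c, h.memLp_grad.const_smul c, h.weakGradient.const_smul c⟩

theorem IsH1.congr_ae {u u' : Plane → ℝ} {g : Plane → Plane} (h : IsH1 U u g)
    (hu : u =ᵐ[volume.restrict U] u') : IsH1 U u' g :=
  ⟨h.memLp.ae_eq hu, h.memLp_grad, fun η h1 h2 h3 i => by
    rw [← h.weakGradient η h1 h2 h3 i]
    exact integral_congr_ae (hu.symm.mul (ae_eq_refl _))⟩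

theorem IsNeumannEigenfunction.const_smul {μ : ℝ} {ψ : Plane → ℝ}
    (h : IsNeumannEigenfunction U μ ψ) {c : ℝ} (hc : c ≠ 0) :
    IsNeumannEigenfunction U μ (c • ψ) := by
  obtain ⟨h0, g, hg, hw⟩ := h
  refine ⟨fun hz => h0 ?_, c • g, hg.const_smul c, fun v gv hv => ?_⟩
  · filter_upwards [hz] with x hx
    simpa [hc] using hx
  · simp only [Pi.smul_apply, smul_eq_mul, real_inner_smul_left, mul_assoc, integral_const_mul,
      hw v gv hv]
    ring

theorem IsNeumannEigenfunction.congr_ae {μ : ℝ} {ψ ψ' : Plane → ℝ}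
    (h : IsNeumannEigenfunction U μ ψ) (hψ : ψ =ᵐ[volume.restrict U] ψ') :
    IsNeumannEigenfunction U μ ψ' := by
  obtain ⟨h0, g, hg, hw⟩ := h
  refine ⟨fun hz => h0 (hψ.trans hz), g, hg.congr_ae hψ, fun v gv hv => ?_⟩
  rw [hw v gv hv]
  congr 1
  exact integral_congr_ae (hψ.mul (ae_eq_refl _))

/-! ### Cosine modes as Neumann eigenfunctions -/

namespace Rect

variable (R : Rect)

/-- The frequency of the `m`-th cosine mode in the direction `i`. -/
noncomputable def freq (i : Fin 2) (m : ℕ) : ℝ := m * Real.pi / (R.hi i - R.lo i)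

/-- The `m`-th cosine mode in the direction `i`. -/
noncomputable def cosMode (i : Fin 2) (m : ℕ) (t : ℝ) : ℝ := Real.cos (R.freq i m * (t - R.lo i))

/-- The product of cosine modes with indices `p`. -/
noncomputable def cosProd (p : Fin 2 → ℕ) (x : Plane) : ℝ := ∏ i, R.cosMode i (p i) (x i)

/-- The Neumann eigenvalue of `cosProd p`. -/
noncomputable def cosEigenvalue (p : Fin 2 → ℕ) : ℝ := ∑ i, R.freq i (p i) ^ 2

theorem contDiff_cosMode (i : Fin 2) (m : ℕ) : ContDiff ℝ ∞ (R.cosMode i m) := by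
  unfold cosMode; fun_prop

theorem freq_mul_length (i : Fin 2) (m : ℕ) : R.freq i m * (R.hi i - R.lo i) = m * Real.pi :=
  div_mul_cancel₀ _ (sub_pos.2 (R.lo_lt_hi i)).ne'

theorem hasDerivAt_cosMode (i : Fin 2) (m : ℕ) (t : ℝ) :
    HasDerivAt (R.cosMode i m) (-(R.freq i m * Real.sin (R.freq i m * (t - R.lo i)))) t := by
  have h := (((hasDerivAt_id t).sub_const (R.lo i)).const_mul (R.freq i m)).cos
  refine h.congr_deriv ?_
  simp only [id]
  ring

theorem hasDerivAt_deriv_cosMode (i : Fin 2) (m : ℕ) (t : ℝ) :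
    HasDerivAt (deriv (R.cosMode i m)) (-(R.freq i m ^ 2 * R.cosMode i m t)) t := by
  have h0 : deriv (R.cosMode i m) = fun t => -(R.freq i m * Real.sin (R.freq i m * (t - R.lo i))) :=
    funext fun t => (R.hasDerivAt_cosMode i m t).deriv
  rw [h0]
  have h := ((((hasDerivAt_id t).sub_const (R.lo i)).const_mul (R.freq i m)).sin.const_mul
    (R.freq i m)).neg
  refine h.congr_deriv ?_
  simp only [id, cosMode]
  ring

theorem deriv_cosMode_lo (i : Fin 2) (m : ℕ) : deriv (R.cosMode i m) (R.lo i) = 0 := by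
  rw [(R.hasDerivAt_cosMode i m _).deriv]; simp

theorem deriv_cosMode_hi (i : Fin 2) (m : ℕ) : deriv (R.cosMode i m) (R.hi i) = 0 := by
  rw [(R.hasDerivAt_cosMode i m _).deriv, freq_mul_length, Real.sin_nat_mul_pi]; simp

theorem contDiff_cosProd (p : Fin 2 → ℕ) : ContDiff ℝ ∞ (R.cosProd p) :=
  contDiff_prod fun i _ => (R.contDiff_cosMode i (p i)).comp
    (EuclideanSpace.proj i : Plane →L[ℝ] ℝ).contDiff

theorem cosProd_eq_mul (p : Fin 2 → ℕ) {i j : Fin 2} (hij : i ≠ j) (x : Plane) :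
    R.cosProd p x = R.cosMode i (p i) (x i) * R.cosMode j (p j) (x j) := by
  have : (Finset.univ : Finset (Fin 2)) = {i, j} := by
    ext l; simp; omega
  rw [cosProd, this, Finset.prod_pair hij]

theorem fderiv_cosProd (p : Fin 2 → ℕ) {i j : Fin 2} (hij : i ≠ j) (x : Plane) :
    fderiv ℝ (R.cosProd p) x (EuclideanSpace.single i 1)
      = deriv (R.cosMode i (p i)) (x i) * R.cosMode j (p j) (x j) := by
  rw [funext (R.cosProd_eq_mul p hij), fderiv_coord_mul_coord
    ((R.contDiff_cosMode i _).differentiable (by simp))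
    ((R.contDiff_cosMode j _).differentiable (by simp)) hij]

/-- The derivative of the cosine mode in direction `i` vanishes at both ends, so integration by
parts holds against every `H¹` function, and a second derivative reproduces the mode times minus its
squared frequency. -/
theorem integral_fderiv_cosProd_mul (p : Fin 2 → ℕ) {v : Plane → ℝ} {gv : Plane → Plane}
    (hv : IsH1 R.domain v gv) (i : Fin 2) :
    ∫ x in R.domain, gv x i * fderiv ℝ (R.cosProd p) x (EuclideanSpace.single i 1)
      = R.freq i (p i) ^ 2 * ∫ x in R.domain, R.cosProd p x * v x := by
  obtain ⟨j, hij⟩ : ∃ j, i ≠ j := ⟨i + 1, by omega⟩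
  have hd : ContDiff ℝ ∞ (deriv (R.cosMode i (p i))) :=
    (contDiff_infty_iff_deriv.1 (R.contDiff_cosMode i (p i))).2
  have h := hv.integral_mul_deriv_eq hij hd (R.contDiff_cosMode j (p j))
    (R.deriv_cosMode_lo i (p i)) (R.deriv_cosMode_hi i (p i))
  simp only [R.fderiv_cosProd p hij]
  rw [← neg_eq_iff_eq_neg] at h
  rw [← h, ← integral_neg, ← integral_const_mul]
  refine integral_congr_ae (ae_of_all _ fun x => ?_)
  simp only [(R.hasDerivAt_deriv_cosMode i (p i) _).deriv, R.cosProd_eq_mul p hij]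
  ring

/-- The antiderivative is a sine that vanishes at both ends, where its argument is `0` and `k π`. -/
theorem integral_cos_int {i : Fin 2} {k : ℤ} (hk : k ≠ 0) :
    ∫ t in R.lo i..R.hi i, Real.cos (k * Real.pi / (R.hi i - R.lo i) * (t - R.lo i)) = 0 := by
  have hL : R.hi i - R.lo i ≠ 0 := (sub_pos.2 (R.lo_lt_hi i)).ne'
  set w : ℝ := k * Real.pi / (R.hi i - R.lo i) with hw
  have hk' : (k : ℝ) ≠ 0 := by exact_mod_cast hk
  have hw0 : w ≠ 0 := div_ne_zero (mul_ne_zero hk' Real.pi_ne_zero) hL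
  have hd : ∀ t, HasDerivAt (fun t => Real.sin (w * (t - R.lo i)) / w)
      (Real.cos (w * (t - R.lo i))) t := fun t => by
    have h := (((hasDerivAt_id t).sub_const (R.lo i)).const_mul w).sin.div_const w
    refine h.congr_deriv ?_
    simp only [id]
    field_simp
  rw [intervalIntegral.integral_eq_sub_of_hasDerivAt (fun t _ => hd t)
    (Continuous.intervalIntegrable (by fun_prop) _ _), hw, div_mul_cancel₀ _ hL,
    Real.sin_int_mul_pi]
  simp

theorem cosMode_mul_cosMode (i : Fin 2) (m n : ℕ) (t : ℝ) :
    R.cosMode i m t * R.cosMode i n t = 1 / 2 *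
      (Real.cos (((m - n : ℤ) : ℝ) * Real.pi / (R.hi i - R.lo i) * (t - R.lo i)) +
        Real.cos (((m + n : ℤ) : ℝ) * Real.pi / (R.hi i - R.lo i) * (t - R.lo i))) := by
  have h1 : ((m - n : ℤ) : ℝ) * Real.pi / (R.hi i - R.lo i) * (t - R.lo i)
      = R.freq i m * (t - R.lo i) - R.freq i n * (t - R.lo i) := by
    simp only [freq]; push_cast; ring
  have h2 : ((m + n : ℤ) : ℝ) * Real.pi / (R.hi i - R.lo i) * (t - R.lo i)
      = R.freq i m * (t - R.lo i) + R.freq i n * (t - R.lo i) := by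
    simp only [freq]; push_cast; ring
  rw [h1, h2, Real.cos_sub, Real.cos_add, cosMode, cosMode]
  ring

theorem integral_cosMode_mul_cosMode {i : Fin 2} {m n : ℕ} (hmn : m ≠ n) :
    ∫ t in R.lo i..R.hi i, R.cosMode i m t * R.cosMode i n t = 0 := by
  simp only [cosMode_mul_cosMode]
  rw [intervalIntegral.integral_const_mul, intervalIntegral.integral_add
    (Continuous.intervalIntegrable (by fun_prop) _ _)
    (Continuous.intervalIntegrable (by fun_prop) _ _),
    integral_cos_int R (by omega), integral_cos_int R (by omega)]
  simp

theorem integral_cosMode_sq_pos (i : Fin 2) (m : ℕ) :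
    0 < ∫ t in R.lo i..R.hi i, R.cosMode i m t * R.cosMode i m t := by
  have hc := (R.contDiff_cosMode i m).continuous
  refine intervalIntegral.integral_pos (R.lo_lt_hi i) (hc.mul hc).continuousOn
    (fun t _ => mul_self_nonneg _) ⟨R.lo i, ⟨le_rfl, (R.lo_lt_hi i).le⟩, ?_⟩
  simp [cosMode]

theorem integral_cosProd_mul_cosProd (p q : Fin 2 → ℕ) :
    ∫ x in R.domain, R.cosProd p x * R.cosProd q x
      = ∏ i, ∫ t in R.lo i..R.hi i, R.cosMode i (p i) t * R.cosMode i (q i) t := by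
  rw [← setIntegral_prod]
  simp only [cosProd, Finset.prod_mul_distrib]

theorem integral_cosProd_mul_of_ne {p q : Fin 2 → ℕ} (hpq : p ≠ q) :
    ∫ x in R.domain, R.cosProd p x * R.cosProd q x = 0 := by
  obtain ⟨i, hi⟩ := Function.ne_iff.1 hpq
  rw [integral_cosProd_mul_cosProd]
  exact Finset.prod_eq_zero (Finset.mem_univ i) (R.integral_cosMode_mul_cosMode hi)

theorem integral_cosProd_sq_pos (p : Fin 2 → ℕ) :
    0 < ∫ x in R.domain, R.cosProd p x * R.cosProd p x := by
  rw [integral_cosProd_mul_cosProd]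
  exact Finset.prod_pos fun i _ => R.integral_cosMode_sq_pos i _

theorem isNeumannEigenfunction_cosProd (p : Fin 2 → ℕ) :
    IsNeumannEigenfunction R.domain (R.cosEigenvalue p) (R.cosProd p) := by
  refine ⟨fun h0 => ?_, _, isH1_of_contDiff R (R.contDiff_cosProd p), fun v gv hv => ?_⟩
  · have : ∫ x in R.domain, R.cosProd p x * R.cosProd p x = 0 := by
      refine integral_eq_zero_of_ae ?_
      filter_upwards [h0] with x hx
      simp [hx]
    exact (R.integral_cosProd_sq_pos p).ne' this
  · have hH := isH1_of_contDiff R (R.contDiff_cosProd p)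
    simp only [PiLp.inner_apply, RCLike.inner_apply, conj_trivial]
    rw [integral_finsetSum]
    · simp only [R.integral_fderiv_cosProd_mul p hv, ← Finset.sum_mul, cosEigenvalue]
    · exact fun i _ => (hv.memLp_grad_apply i).integrable_mul (hH.memLp_grad_apply i)

/-! ### Completeness of the cosine products -/

/-- The product of cosine modes as a continuous function on the closed rectangle. -/
noncomputable def cosProdMap (p : Fin 2 → ℕ) : C(R.closedDomain, ℝ) :=
  ⟨fun x => R.cosProd p x, (R.contDiff_cosProd p).continuous.comp continuous_subtype_val⟩

/-- Cosine is even, so the difference frequency is again that of a mode with a natural index. This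
makes the span of the modes an algebra. -/
theorem cosMode_mul_cosMode_eq (i : Fin 2) (m n : ℕ) (t : ℝ) :
    R.cosMode i m t * R.cosMode i n t
      = 1 / 2 * (R.cosMode i ((m : ℤ) - n).natAbs t + R.cosMode i (m + n) t) := by
  rw [cosMode_mul_cosMode]
  simp only [cosMode, freq]
  congr 2
  · rcases le_total n m with h | h
    · have : (((m : ℤ) - n).natAbs : ℝ) = ((m : ℤ) - n : ℤ) := by
        rw [← Int.cast_natCast]; congr 1; omega
      rw [this]
    · have : (((m : ℤ) - n).natAbs : ℝ) = -((m : ℤ) - n : ℤ) := by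
        rw [← Int.cast_natCast, ← Int.cast_neg]; congr 1; omega
      rw [this, ← Real.cos_neg]
      congr 1
      ring

/-- The linear span of the cosine products is closed under multiplication. -/
theorem mul_mem_span_cosProdMap {f g : C(R.closedDomain, ℝ)}
    (hf : f ∈ Submodule.span ℝ (range R.cosProdMap))
    (hg : g ∈ Submodule.span ℝ (range R.cosProdMap)) :
    f * g ∈ Submodule.span ℝ (range R.cosProdMap) := by
  have h := Submodule.mul_mem_mul hf hg
  rw [Submodule.span_mul_span] at h
  refine Submodule.span_le.2 ?_ h
  rintro _ ⟨_, ⟨p, rfl⟩, _, ⟨q, rfl⟩, rfl⟩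
  let d : Fin 2 → ℕ := fun i => ((p i : ℤ) - q i).natAbs
  have key : R.cosProdMap p * R.cosProdMap q = (1 / 4 : ℝ) • (R.cosProdMap d +
      R.cosProdMap ![d 0, p 1 + q 1] + R.cosProdMap ![p 0 + q 0, d 1] +
      R.cosProdMap ![p 0 + q 0, p 1 + q 1]) := by
    ext x
    simp only [cosProdMap, ContinuousMap.mul_apply, ContinuousMap.coe_mk, ContinuousMap.smul_apply,
      ContinuousMap.add_apply, cosProd, Fin.prod_univ_two, smul_eq_mul, Matrix.cons_val_zero,
      Matrix.cons_val_one]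
    rw [mul_mul_mul_comm, cosMode_mul_cosMode_eq, cosMode_mul_cosMode_eq]
    ring
  have hm : ∀ p, R.cosProdMap p ∈ Submodule.span ℝ (range R.cosProdMap) := fun p =>
    Submodule.subset_span ⟨p, rfl⟩
  simp only [key, SetLike.mem_coe]
  exact Submodule.smul_mem _ _ (add_mem (add_mem (add_mem (hm _) (hm _)) (hm _)) (hm _))

theorem cosProd_zero (x : Plane) : R.cosProd 0 x = 1 := by
  simp [cosProd, cosMode, freq]

/-- The algebra of linear combinations of cosine products. -/
noncomputable def cosAlgebra : Subalgebra ℝ C(R.closedDomain, ℝ) :=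
  (Submodule.span ℝ (range R.cosProdMap)).toSubalgebra
    (Submodule.subset_span ⟨0, by ext x; exact R.cosProd_zero x⟩)
    (fun _ _ => R.mul_mem_span_cosProdMap)

theorem injOn_cosMode_one (i : Fin 2) : InjOn (R.cosMode i 1) (Icc (R.lo i) (R.hi i)) := by
  have hL : 0 < R.hi i - R.lo i := sub_pos.2 (R.lo_lt_hi i)
  have hw : 0 < R.freq i 1 := by
    rw [freq, Nat.cast_one, one_mul]; exact div_pos Real.pi_pos hL
  have hmem : ∀ s ∈ Icc (R.lo i) (R.hi i), R.freq i 1 * (s - R.lo i) ∈ Icc 0 Real.pi :=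
    fun s hs => by
      refine ⟨mul_nonneg hw.le (sub_nonneg.2 hs.1), ?_⟩
      have := mul_le_mul_of_nonneg_left (sub_le_sub_right hs.2 (R.lo i)) hw.le
      rwa [freq_mul_length, Nat.cast_one, one_mul] at this
  intro s hs t ht hst
  have := mul_left_cancel₀ hw.ne' (Real.injOn_cos (hmem s hs) (hmem t ht) hst)
  linarith

/-- Mode `1` in a coordinate where the points differ and mode `0`, which is constant, in the other:
half a period of cosine is injective. -/
theorem cosAlgebra_separatesPoints : R.cosAlgebra.SeparatesPoints := by
  intro x y hxy
  obtain ⟨i, hi⟩ : ∃ i, x.1 i ≠ y.1 i := by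
    by_contra! h
    exact hxy (Subtype.ext (PiLp.ext h))
  refine ⟨_, ⟨R.cosProdMap (Pi.single i 1), Submodule.subset_span ⟨_, rfl⟩, rfl⟩, fun h => hi ?_⟩
  refine R.injOn_cosMode_one i (x.2 i) (y.2 i) ?_
  obtain ⟨j, hij⟩ : ∃ j, i ≠ j := ⟨i + 1, by omega⟩
  have h0 : ∀ t, R.cosMode j 0 t = 1 := fun t => by simp [cosMode, freq]
  simpa [cosProdMap, R.cosProd_eq_mul _ hij, hij.symm, h0] using h

/-- A square integrable function orthogonal to all cosine products is orthogonal to all continuous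
functions. -/
theorem integral_mul_eq_zero_of_continuous {f : Plane → ℝ}
    (hf : MemLp f 2 (volume.restrict R.domain))
    (h : ∀ p, ∫ x in R.domain, f x * R.cosProd p x = 0) {g : Plane → ℝ} (hg : Continuous g) :
    ∫ x in R.domain, f x * g x = 0 := by
  have : CompactSpace R.closedDomain := isCompact_iff_compactSpace.1 R.isCompact_closedDomain
  have hint : ∀ {q : Plane → ℝ}, Continuous q →
      Integrable (fun x => f x * q x) (volume.restrict R.domain) := fun hq =>
    hf.integrable_mul (memLp_of_continuous R hq 2)
  have hspan : ∀ q ∈ Submodule.span ℝ (range R.cosProdMap), ∃ Q : Plane → ℝ, Continuous Q ∧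
      (∀ x, q x = Q x) ∧ ∫ x in R.domain, f x * Q x = 0 := by
    intro q hq
    induction hq using Submodule.span_induction with
    | mem q hq =>
      obtain ⟨p, rfl⟩ := hq
      exact ⟨R.cosProd p, (R.contDiff_cosProd p).continuous, fun _ => rfl, h p⟩
    | zero => exact ⟨0, continuous_const, fun _ => rfl, by simp⟩
    | add q q' _ _ ih ih' =>
      obtain ⟨Q, h1, h2, h3⟩ := ih
      obtain ⟨Q', h1', h2', h3'⟩ := ih'
      refine ⟨Q + Q', h1.add h1', fun x => by simp [h2, h2'], ?_⟩
      simp only [Pi.add_apply, mul_add]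
      rw [integral_add (hint h1) (hint h1'), h3, h3', add_zero]
    | smul c q _ ih =>
      obtain ⟨Q, h1, h2, h3⟩ := ih
      refine ⟨c • Q, h1.const_smul c, fun x => by simp [h2], ?_⟩
      simp only [Pi.smul_apply, smul_eq_mul, mul_left_comm _ c]
      rw [integral_const_mul, h3, mul_zero]
  by_contra hne
  have hpos : 0 < |∫ x in R.domain, f x * g x| := abs_pos.2 hne
  have hI0 : 0 ≤ ∫ x in R.domain, |f x| := integral_nonneg fun _ => abs_nonneg _
  -- A uniform `ε`-approximation of `g` from the span changes the integral by at most `ε ∫ |f|`. The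
  -- `1 +` in the witness keeps the denominator positive.
  obtain ⟨ε, hε, hlt⟩ : ∃ ε > 0, ε * ∫ x in R.domain, |f x| < |∫ x in R.domain, f x * g x| := by
    refine ⟨|∫ x in R.domain, f x * g x| / (1 + ∫ x in R.domain, |f x|), by positivity, ?_⟩
    rw [div_mul_eq_mul_div, div_lt_iff₀ (by positivity)]
    nlinarith
  let G : C(R.closedDomain, ℝ) := ⟨fun x => g x, hg.comp continuous_subtype_val⟩
  have hG : G ∈ R.cosAlgebra.topologicalClosure := by
    rw [ContinuousMap.subalgebra_topologicalClosure_eq_top_of_separatesPoints _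
      R.cosAlgebra_separatesPoints]
    trivial
  obtain ⟨q, hq, hqG⟩ := Metric.mem_closure_iff.1 hG ε hε
  obtain ⟨Q, hQc, hQ, hQ0⟩ := hspan q hq
  have hdiff : ∫ x in R.domain, f x * g x = ∫ x in R.domain, f x * (g x - Q x) := by
    simp only [mul_sub]
    rw [integral_sub (hint hg) (hint hQc), hQ0, sub_zero]
  have hle : |∫ x in R.domain, f x * g x| ≤ ε * ∫ x in R.domain, |f x| := by
    rw [hdiff, ← integral_const_mul, ← Real.norm_eq_abs]
    refine norm_integral_le_of_norm_le ((hf.integrable one_le_two).abs.const_mul ε) ?_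
    filter_upwards [ae_restrict_mem R.measurableSet_domain] with x hx
    have hx' := (ContinuousMap.dist_apply_le_dist (f := G) (g := q)
      ⟨x, R.domain_subset_closedDomain hx⟩).trans hqG.le
    rw [hQ, Real.dist_eq] at hx'
    rw [norm_mul, mul_comm]
    exact mul_le_mul_of_nonneg_right hx' (norm_nonneg _)
  exact absurd hle (not_le.2 hlt)

/-- Orthogonality to continuous functions covers the smooth compactly supported ones, and the
fundamental lemma of the calculus of variations applies. -/
theorem ae_eq_zero_of_integral_mul_cosProd {f : Plane → ℝ}
    (hf : MemLp f 2 (volume.restrict R.domain))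
    (h : ∀ p, ∫ x in R.domain, f x * R.cosProd p x = 0) :
    f =ᵐ[volume.restrict R.domain] 0 := by
  refine ae_eq_zero_of_integral_contDiff_smul_eq_zero
    (hf.integrable one_le_two).locallyIntegrable fun g hg _ => ?_
  simpa only [smul_eq_mul, mul_comm] using
    R.integral_mul_eq_zero_of_continuous hf h hg.continuous

/-! ### Ordering the eigenvalues and building the eigenbasis -/

theorem finite_cosEigenvalue_le (c : ℝ) : {p | R.cosEigenvalue p ≤ c}.Finite := by
  have hb : ∀ i, ∃ N : ℕ, ∀ m, R.freq i m ^ 2 ≤ c → m ≤ N := fun i => by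
    have hw : 0 < Real.pi / (R.hi i - R.lo i) :=
      div_pos Real.pi_pos (sub_pos.2 (R.lo_lt_hi i))
    -- Beyond `N` the frequency `w` exceeds `c + 1`, which is incompatible with `w ^ 2 ≤ c` because
    -- `w ^ 2 ≥ 2 * w - 1`.
    obtain ⟨N, hN⟩ := exists_nat_gt ((c + 1) / (Real.pi / (R.hi i - R.lo i)))
    refine ⟨N, fun m hm => ?_⟩
    by_contra hlt
    have hmN : (N : ℝ) ≤ m := by exact_mod_cast (not_le.1 hlt).le
    have h1 : c + 1 < R.freq i m := by
      rw [div_lt_iff₀ hw] at hN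
      have : R.freq i m = m * (Real.pi / (R.hi i - R.lo i)) := mul_div_assoc _ _ _
      rw [this]
      exact hN.trans_le (mul_le_mul_of_nonneg_right hmN hw.le)
    nlinarith [sq_nonneg (R.freq i m), sq_nonneg (R.freq i m - 1)]
  choose N hN using hb
  refine (finite_Iic N).subset fun p hp i => hN i _ (le_trans ?_ hp)
  exact Finset.single_le_sum (f := fun i => R.freq i (p i) ^ 2) (fun _ _ => sq_nonneg _)
    (Finset.mem_univ i)

theorem cosEigenvalue_zero : R.cosEigenvalue 0 = 0 := by
  simp [cosEigenvalue, freq]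

theorem cosEigenvalue_pos {p : Fin 2 → ℕ} (hp : p ≠ 0) : 0 < R.cosEigenvalue p := by
  obtain ⟨i, hi⟩ := Function.ne_iff.1 hp
  refine Finset.sum_pos' (fun _ _ => sq_nonneg _) ⟨i, Finset.mem_univ i, ?_⟩
  have hp0 : (p i : ℝ) ≠ 0 := by exact_mod_cast hi
  exact pow_pos (lt_of_le_of_ne (div_nonneg (by positivity) (sub_pos.2 (R.lo_lt_hi i)).le)
    (div_ne_zero (mul_ne_zero hp0 Real.pi_ne_zero) (sub_pos.2 (R.lo_lt_hi i)).ne').symm) 2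

theorem memLp_cosProd (p : Fin 2 → ℕ) : MemLp (R.cosProd p) 2 (volume.restrict R.domain) :=
  memLp_of_continuous R (R.contDiff_cosProd p).continuous 2

/-- The product of cosine modes as an element of `L²`. -/
noncomputable def cosLp (p : Fin 2 → ℕ) : Lp ℝ 2 (volume.restrict R.domain) :=
  (R.memLp_cosProd p).toLp _

theorem inner_cosLp (p : Fin 2 → ℕ) (f : Lp ℝ 2 (volume.restrict R.domain)) :
    inner ℝ (R.cosLp p) f = ∫ x in R.domain, f x * R.cosProd p x := by
  rw [L2.inner_def]
  refine integral_congr_ae ?_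
  filter_upwards [(R.memLp_cosProd p).coeFn_toLp] with x hx
  simp [cosLp, hx]

theorem inner_cosLp_cosLp (p q : Fin 2 → ℕ) :
    inner ℝ (R.cosLp p) (R.cosLp q) = ∫ x in R.domain, R.cosProd q x * R.cosProd p x := by
  rw [inner_cosLp]
  refine integral_congr_ae ?_
  filter_upwards [(R.memLp_cosProd q).coeFn_toLp] with x hx
  simp only [cosLp, hx]

theorem cosLp_ne_zero (p : Fin 2 → ℕ) : R.cosLp p ≠ 0 := fun h => by
  have := R.integral_cosProd_sq_pos p
  rw [← inner_cosLp_cosLp, h, inner_zero_left] at this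
  exact lt_irrefl _ this

/-- The Neumann Laplacian of a rectangle has an orthonormal basis of eigenfunctions. -/
theorem exists_isNeumannEigenbasis :
    ∃ (lam : ℕ → ℝ) (ψ : HilbertBasis ℕ ℝ (Lp ℝ 2 (volume.restrict R.domain))),
      IsNeumannEigenbasis R.domain lam ψ := by
  have : Encodable (Fin 2 → ℕ) := Encodable.ofCountable _
  obtain ⟨e, he⟩ := exists_equiv_nat_monotone R.cosEigenvalue R.finite_cosEigenvalue_le
  have hn : ∀ p, ‖R.cosLp p‖⁻¹ ≠ 0 := fun p => inv_ne_zero (norm_ne_zero_iff.2 (R.cosLp_ne_zero p))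
  let v : ℕ → Lp ℝ 2 (volume.restrict R.domain) := fun k => ‖R.cosLp (e k)‖⁻¹ • R.cosLp (e k)
  have hv : Orthonormal ℝ v := by
    refine ⟨fun k => ?_, fun k l hkl => ?_⟩
    · rw [norm_smul, norm_inv, norm_norm, inv_mul_cancel₀ (norm_ne_zero_iff.2 (R.cosLp_ne_zero _))]
    · simp only [v]
      rw [real_inner_smul_left, real_inner_smul_right, inner_cosLp_cosLp,
        R.integral_cosProd_mul_of_ne (e.injective.ne hkl.symm)]
      simp
  have hsp : (Submodule.span ℝ (range v))ᗮ = ⊥ := by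
    refine (Submodule.eq_bot_iff _).2 fun f hf => ?_
    refine Lp.eq_zero_iff_ae_eq_zero.2
      (R.ae_eq_zero_of_integral_mul_cosProd (Lp.memLp f) fun p => ?_)
    have h := (Submodule.mem_orthogonal _ _).1 hf _ (Submodule.subset_span ⟨e.symm p, rfl⟩)
    simp only [v, Equiv.apply_symm_apply, real_inner_smul_left] at h
    rw [← inner_cosLp]
    exact (mul_eq_zero.1 h).resolve_left (hn p)
  -- Only the constant mode has eigenvalue `0`, so the sorted enumeration starts with it and every
  -- later eigenvalue is positive.
  have hzero : e 0 = 0 := by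
    by_contra h0
    have h1 := he (Nat.zero_le (e.symm 0))
    simp only [Function.comp_apply, Equiv.apply_symm_apply, cosEigenvalue_zero] at h1
    exact absurd h1 (not_le.2 (R.cosEigenvalue_pos h0))
  refine ⟨R.cosEigenvalue ∘ e, HilbertBasis.mkOfOrthogonalEqBot hv hsp, ?_, ?_, he, fun k => ?_⟩
  · rw [Function.comp_apply, hzero, cosEigenvalue_zero]
  · exact R.cosEigenvalue_pos fun h => one_ne_zero (e.injective (h.trans hzero.symm))
  · rw [HilbertBasis.coe_mkOfOrthogonalEqBot]
    refine ((R.isNeumannEigenfunction_cosProd (e k)).const_smul (hn (e k))).congr_ae ?_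
    filter_upwards [Lp.coeFn_smul ‖R.cosLp (e k)‖⁻¹ (R.cosLp (e k)),
      (R.memLp_cosProd (e k)).coeFn_toLp] with x h1 h2
    rw [h1, Pi.smul_apply, Pi.smul_apply, cosLp, h2]

end Rect

/-! ### `L²` inner products and closedness of `H¹` -/

theorem inner_toLp {α E : Type*} [MeasurableSpace α] {μ : Measure α} [NormedAddCommGroup E]
    [InnerProductSpace ℝ E] {f g : α → E} (hf : MemLp f 2 μ) (hg : MemLp g 2 μ) :
    inner ℝ (hf.toLp f) (hg.toLp g) = ∫ x, inner ℝ (f x) (g x) ∂μ := by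
  rw [L2.inner_def]
  refine integral_congr_ae ?_
  filter_upwards [hf.coeFn_toLp, hg.coeFn_toLp] with x h1 h2
  rw [h1, h2]

theorem norm_toLp_sq {α E : Type*} [MeasurableSpace α] {μ : Measure α} [NormedAddCommGroup E]
    [InnerProductSpace ℝ E] {f : α → E} (hf : MemLp f 2 μ) :
    ‖hf.toLp f‖ ^ 2 = ∫ x, ‖f x‖ ^ 2 ∂μ := by
  rw [← real_inner_self_eq_norm_sq, inner_toLp]
  simp only [real_inner_self_eq_norm_sq]

theorem inner_toLp_real {f g : Plane → ℝ} (hf : MemLp f 2 (volume.restrict U))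
    (hg : MemLp g 2 (volume.restrict U)) :
    inner ℝ (hf.toLp f) (hg.toLp g) = ∫ x in U, f x * g x := by
  rw [inner_toLp]
  simp [mul_comm]

theorem inner_coe_toLp (ψ : Lp ℝ 2 (volume.restrict U)) {f : Plane → ℝ}
    (hf : MemLp f 2 (volume.restrict U)) :
    inner ℝ ψ (hf.toLp f) = ∫ x in U, f x * ψ x := by
  conv_lhs => rw [← Lp.toLp_coeFn ψ (Lp.memLp ψ)]
  rw [real_inner_comm, inner_toLp_real]

theorem IsH1.congr_grad_ae {u : Plane → ℝ} {g g' : Plane → Plane} (h : IsH1 U u g)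
    (hg : g =ᵐ[volume.restrict U] g') : IsH1 U u g' :=
  ⟨h.memLp, h.memLp_grad.ae_eq hg, fun η h1 h2 h3 i => by
    rw [h.weakGradient η h1 h2 h3 i]
    congr 1
    refine integral_congr_ae ?_
    filter_upwards [hg] with x hx
    rw [hx]⟩

/-- The space `H¹` is closed under simultaneous `L²` convergence of functions and gradients. -/
theorem isH1_of_hasSum (R : Rect) {u : ℕ → Lp ℝ 2 (volume.restrict R.domain)}
    {G : ℕ → Lp Plane 2 (volume.restrict R.domain)} (h : ∀ k, IsH1 R.domain (u k) (G k))
    {c : ℕ → ℝ} {φ : Lp ℝ 2 (volume.restrict R.domain)}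
    {g : Lp Plane 2 (volume.restrict R.domain)} (hφ : HasSum (fun k => c k • u k) φ)
    (hg : HasSum (fun k => c k • G k) g) : IsH1 R.domain φ g := by
  refine ⟨Lp.memLp _, Lp.memLp _, fun η h1 h2 h3 i => ?_⟩
  set w : Plane := EuclideanSpace.single i 1 with hw
  have hη : Continuous fun x => fderiv ℝ η x w :=
    (h1.continuous_fderiv (by simp)).clm_apply continuous_const
  have hη1 := memLp_of_continuous R hη 2
  have hη2 : MemLp (fun x => η x • w) 2 (volume.restrict R.domain) :=
    memLp_of_continuous R (h1.continuous.smul continuous_const) 2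
  have e1 (f : Lp ℝ 2 (volume.restrict R.domain)) :
      inner ℝ (hη1.toLp _) f = ∫ x in R.domain, f x * fderiv ℝ η x w := by
    conv_lhs => rw [← Lp.toLp_coeFn f (Lp.memLp f)]
    rw [real_inner_comm, inner_toLp_real]
  have e2 (f : Lp Plane 2 (volume.restrict R.domain)) :
      inner ℝ (hη2.toLp _) f = ∫ x in R.domain, f x i * η x := by
    conv_lhs => rw [← Lp.toLp_coeFn f (Lp.memLp f)]
    rw [inner_toLp]
    refine integral_congr_ae (ae_of_all _ fun x => ?_)
    simp [hw, real_inner_smul_left, EuclideanSpace.inner_single_left, mul_comm]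
  -- For a fixed `η` both sides of the weak gradient identity are continuous linear functionals on
  -- `L²`, so it passes termwise to the sums.
  have s1 := hφ.mapL (innerSL ℝ (hη1.toLp _))
  have s2 := (hg.mapL (innerSL ℝ (hη2.toLp _))).neg
  simp only [innerSL_apply_apply, real_inner_smul_right] at s1 s2
  have e3 (k : ℕ) : ∫ x in R.domain, u k x * fderiv ℝ η x w
      = - ∫ x in R.domain, G k x i * η x := (h k).weakGradient η h1 h2 h3 i
  simp only [e1, e2, e3, mul_neg] at s1 s2
  exact s1.unique s2

/-! ### Expansions in an eigenbasis and solvability -/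

namespace IsNeumannEigenbasis

variable {R : Rect} {lam : ℕ → ℝ} {ψ : HilbertBasis ℕ ℝ (Lp ℝ 2 (volume.restrict R.domain))}

theorem lam_succ_pos (h : IsNeumannEigenbasis R.domain lam ψ) (k : ℕ) : 0 < lam (k + 1) :=
  h.lam_one_pos.trans_le (h.lam_mono (by omega))

/-- Puts the gradients in `L²` as elements of `Lp`, so that series of them can be formed. -/
theorem exists_grad (h : IsNeumannEigenbasis R.domain lam ψ) :
    ∃ G : ℕ → Lp Plane 2 (volume.restrict R.domain), (∀ k, IsH1 R.domain (ψ k) (G k)) ∧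
      ∀ k (v : Plane → ℝ) (gv : Plane → Plane) (hv : IsH1 R.domain v gv),
        inner ℝ (G k) (hv.memLp_grad.toLp gv) = lam k * ∫ x in R.domain, v x * ψ k x := by
  choose g hg hw using fun k => (h.eigen k).2
  refine ⟨fun k => (hg k).memLp_grad.toLp (g k), fun k =>
    (hg k).congr_grad_ae (hg k).memLp_grad.coeFn_toLp.symm, fun k v gv hv => ?_⟩
  rw [inner_toLp, hw k v gv hv]
  simp only [mul_comm]

/-- The weak equation tested with the constant `1` reads `0 = lam (k + 1) * ∫ ψ (k + 1)`. -/
theorem integral_succ_eq_zero (h : IsNeumannEigenbasis R.domain lam ψ) (k : ℕ) :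
    ∫ x in R.domain, ψ (k + 1) x = 0 := by
  obtain ⟨-, g, hg, hw⟩ := h.eigen (k + 1)
  have h1 := hw _ _ (isH1_of_contDiff R (u := fun _ => 1) contDiff_const)
  simp only [fderiv_fun_const, Pi.zero_apply, _root_.zero_apply, mul_one] at h1
  have h2 : (WithLp.toLp 2 fun _ : Fin 2 => (0 : ℝ)) = 0 := rfl
  simp only [h2, inner_zero_right, integral_zero] at h1
  exact (mul_eq_zero.1 h1.symm).resolve_left (h.lam_succ_pos k).ne'

/-- Functions of zero mean are orthogonal to the first eigenfunction. -/
theorem inner_zero_eq_zero (h : IsNeumannEigenbasis R.domain lam ψ) {f : Plane → ℝ}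
    (hf : MemLp f 2 (volume.restrict R.domain)) (hf0 : ∫ x in R.domain, f x = 0) :
    inner ℝ (ψ 0) (hf.toLp f) = 0 := by
  have h1 : MemLp (fun _ => (1 : ℝ)) 2 (volume.restrict R.domain) := memLp_const 1
  have hk : ∀ k ≠ 0, inner ℝ (h1.toLp _) (ψ k) = 0 := fun k hk => by
    obtain ⟨k, rfl⟩ := Nat.exists_eq_succ_of_ne_zero hk
    rw [real_inner_comm, inner_coe_toLp]
    simpa using h.integral_succ_eq_zero k
  -- Parseval against the constant `1` collapses to the term `k = 0`. Taking `x = 1` shows that `⟨1,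
  -- ψ 0⟩ ≠ 0`, since the area is positive; taking `x = f` then gives the claim.
  have hs (x : Lp ℝ 2 (volume.restrict R.domain)) :
      inner ℝ (h1.toLp _) x = inner ℝ (h1.toLp _) (ψ 0) * inner ℝ (ψ 0) x :=
    (ψ.hasSum_inner_mul_inner _ x).unique
      (hasSum_single 0 fun k hk0 => by rw [hk k hk0, zero_mul])
  have h11 : inner ℝ (h1.toLp _) (h1.toLp _) = volume.real R.domain := by
    rw [inner_toLp_real]; simp
  have hne : inner ℝ (h1.toLp _) (ψ 0) ≠ 0 := fun h0 => by
    have := hs (h1.toLp _)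
    rw [h11, h0, zero_mul] at this
    exact R.volume_real_domain_pos.ne' this
  have h2 := hs (hf.toLp f)
  rw [inner_toLp_real] at h2
  simp only [one_mul, hf0] at h2
  exact (mul_eq_zero.1 h2.symm).resolve_left hne

/-- Parseval without its vanishing zeroth term. Taking `v = r` yields the variance, `v = φ` the
energy, and a general `H¹` function `v` the weak equation. -/
theorem hasSum_inner_succ (h : IsNeumannEigenbasis R.domain lam ψ) {f v : Plane → ℝ}
    (hf : MemL2Zero R.domain f) (hv : MemLp v 2 (volume.restrict R.domain)) :
    HasSum (fun k => inner ℝ (ψ (k + 1)) (hf.memLp.toLp f) * inner ℝ (ψ (k + 1)) (hv.toLp v))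
      (∫ x in R.domain, f x * v x) := by
  have h1 := (ψ.hasSum_inner_mul_inner (hf.memLp.toLp f) (hv.toLp v)).comp_succ_of_eq_zero (by
    rw [real_inner_comm, h.inner_zero_eq_zero hf.memLp hf.integral_eq_zero, zero_mul])
  rw [inner_toLp_real] at h1
  simpa only [real_inner_comm] using h1

/-- The Neumann problem has a solution, given by the eigenfunction expansion. -/
theorem exists_isNeumannSolution (h : IsNeumannEigenbasis R.domain lam ψ) {r : Plane → ℝ}
    (hr : MemL2Zero R.domain r) : ∃ φ g, IsNeumannSolution R.domain r φ g := by
  obtain ⟨G, hG, hGw⟩ := h.exists_grad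
  set a : ℕ → ℝ := fun k => inner ℝ (ψ (k + 1)) (hr.memLp.toLp r)
  have hsum : Summable fun k => a k ^ 2 := by
    simpa only [← pow_two] using (h.hasSum_inner_succ hr hr.memLp).summable
  have hlam := h.lam_succ_pos
  -- The eigenvalue equation for `ψ k`, tested with `ψ l`.
  have hGG (k l : ℕ) : inner ℝ (G k) (G l) = lam k * inner ℝ (ψ k) (ψ l) := by
    have h1 := hGw k _ _ (hG l)
    rw [Lp.toLp_coeFn] at h1
    rw [h1, ← inner_coe_toLp (ψ k) (Lp.memLp (ψ l)), Lp.toLp_coeFn]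
  have hψ := orthonormal_iff_ite.1 ψ.orthonormal
  have hON : Orthonormal ℝ fun k => (√(lam (k + 1)))⁻¹ • G (k + 1) := by
    refine orthonormal_iff_ite.2 fun k l => ?_
    rw [real_inner_smul_left, real_inner_smul_right, hGG, hψ]
    simp only [add_left_inj]
    split_ifs with hkl
    · subst hkl
      have h2 := Real.mul_self_sqrt (hlam k).le
      have h3 := (Real.sqrt_pos.2 (hlam k)).ne'
      field_simp
      nlinarith
    · simp
  have hsφ : Summable fun k => (a k / lam (k + 1)) • ψ (k + 1) := by
    refine (ψ.orthonormal.comp _ (add_left_injective 1)).summable_smul ?_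
    refine Summable.of_nonneg_of_le (fun k => sq_nonneg _) (fun k => ?_)
      (hsum.mul_left ((lam 1)⁻¹ ^ 2))
    rw [div_eq_inv_mul, mul_pow]
    have := h.lam_mono (show 1 ≤ k + 1 by omega)
    have := h.lam_one_pos
    gcongr
    exact (inv_pos.2 (hlam k)).le
  -- Relative to the normalised gradients the coefficients are `a k / √(lam (k + 1))`, whose squares
  -- are at most `a k ^ 2 / lam 1`.
  have hsg : Summable fun k => (a k / lam (k + 1)) • G (k + 1) := by
    have h1 : Summable fun k => (a k / √(lam (k + 1))) ^ 2 := by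
      refine Summable.of_nonneg_of_le (fun k => sq_nonneg _) (fun k => ?_)
        (hsum.mul_left (lam 1)⁻¹)
      rw [div_pow, Real.sq_sqrt (hlam k).le, div_eq_inv_mul]
      have := h.lam_mono (show 1 ≤ k + 1 by omega)
      have := h.lam_one_pos
      gcongr
    refine (hON.summable_smul h1).congr fun k => ?_
    rw [smul_smul]
    congr 1
    rw [← div_eq_mul_inv, div_div, Real.mul_self_sqrt (hlam k).le]
  obtain ⟨φ, hφ⟩ := hsφ
  obtain ⟨g, hg⟩ := hsg
  refine ⟨φ, g, isH1_of_hasSum R (fun k => hG (k + 1)) hφ hg, ?_, fun v gv hv => ?_⟩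
  · have h1 : MemLp (fun _ => (1 : ℝ)) 2 (volume.restrict R.domain) := memLp_const 1
    have h2 := hφ.mapL (innerSL ℝ (h1.toLp _))
    have h3 (f : Lp ℝ 2 (volume.restrict R.domain)) :
        inner ℝ (h1.toLp _) f = ∫ x in R.domain, f x := by
      rw [real_inner_comm, inner_coe_toLp]; simp
    simp only [innerSL_apply_apply, real_inner_smul_right] at h2
    simp only [h3, h.integral_succ_eq_zero, mul_zero] at h2
    exact h2.unique hasSum_zero
  · have h1 := hg.mapL (innerSL ℝ (hv.memLp_grad.toLp gv))
    have h2 : inner ℝ (hv.memLp_grad.toLp gv) g = ∫ x in R.domain, inner ℝ (g x) (gv x) := by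
      rw [← inner_toLp (Lp.memLp g) hv.memLp_grad, Lp.toLp_coeFn, real_inner_comm]
    simp only [innerSL_apply_apply, real_inner_smul_right, h2] at h1
    -- The eigenvalue produced by pairing gradients cancels the denominator, leaving the Parseval
    -- series of `∫ r v`.
    have h3 : (fun k => a k / lam (k + 1) * inner ℝ (hv.memLp_grad.toLp gv) (G (k + 1)))
        = fun k => a k * inner ℝ (ψ (k + 1)) (hv.memLp.toLp v) := funext fun k => by
      rw [real_inner_comm, hGw _ _ _ hv, inner_coe_toLp _ hv.memLp, ← mul_assoc,
        div_mul_cancel₀ _ (hlam k).ne']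
    rw [h3] at h1
    exact h1.unique (h.hasSum_inner_succ hr hv.memLp)

end IsNeumannEigenbasis

/-! ### Uniqueness, energy and the dual norm -/

namespace IsNeumannSolution

variable {R : Rect} {lam : ℕ → ℝ} {ψ : HilbertBasis ℕ ℝ (Lp ℝ 2 (volume.restrict R.domain))}
  {r φ : Plane → ℝ} {g : Plane → Plane}

/-- The Neumann problem tested with `ψ (k + 1)` and the eigenvalue equation tested with `φ` have the
same left side. -/
theorem inner_succ_eq (hs : IsNeumannSolution R.domain r φ g)
    (h : IsNeumannEigenbasis R.domain lam ψ) (k : ℕ) :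
    inner ℝ (ψ (k + 1)) (hs.isH1.memLp.toLp φ)
      = (∫ x in R.domain, r x * ψ (k + 1) x) / lam (k + 1) := by
  obtain ⟨G, hG, hGw⟩ := h.exists_grad
  rw [eq_div_iff (h.lam_succ_pos k).ne', inner_coe_toLp, mul_comm, ← hGw (k + 1) φ g hs.isH1,
    ← hs.weak_eq _ _ (hG (k + 1)), ← inner_toLp hs.isH1.memLp_grad (Lp.memLp (G (k + 1))),
    Lp.toLp_coeFn, real_inner_comm]

theorem ae_eq {φ' : Plane → ℝ} {g' : Plane → Plane} (hs : IsNeumannSolution R.domain r φ g)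
    (hs' : IsNeumannSolution R.domain r φ' g') (h : IsNeumannEigenbasis R.domain lam ψ) :
    φ =ᵐ[volume.restrict R.domain] φ' := by
  rw [← MemLp.toLp_eq_toLp_iff hs.isH1.memLp hs'.isH1.memLp]
  refine ψ.repr.injective (lp.ext (funext fun k => ?_))
  rw [ψ.repr_apply_apply, ψ.repr_apply_apply]
  cases k with
  | zero => rw [h.inner_zero_eq_zero _ hs.integral_eq_zero,
      h.inner_zero_eq_zero _ hs'.integral_eq_zero]
  | succ k => rw [hs.inner_succ_eq h, hs'.inner_succ_eq h]

theorem integral_mul_eq (hs : IsNeumannSolution R.domain r φ g) :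
    ∫ x in R.domain, r x * φ x = ∫ x in R.domain, ‖g x‖ ^ 2 := by
  rw [← hs.weak_eq φ g hs.isH1]
  simp only [real_inner_self_eq_norm_sq]

/-- The `H⁻¹` norm is attained at the normalised solution of the Neumann problem. -/
theorem isGreatest_dualValues (hs : IsNeumannSolution R.domain r φ g) :
    IsGreatest (dualValues R.domain r) ‖hs.isH1.memLp_grad.toLp g‖ := by
  set N := ‖hs.isH1.memLp_grad.toLp g‖ with hN
  have hN2 : N ^ 2 = ∫ x in R.domain, ‖g x‖ ^ 2 := norm_toLp_sq hs.isH1.memLp_grad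
  constructor
  -- If `N = 0`, then `N⁻¹ = 0` and the zero function attains the value `0`, so no separate witness
  -- is needed.
  · refine ⟨N⁻¹ • φ, N⁻¹ • g, hs.isH1.const_smul _, ?_, ?_⟩
    · simp only [Pi.smul_apply, norm_smul, mul_pow, integral_const_mul, ← hN2, Real.norm_eq_abs,
        sq_abs]
      rw [← mul_pow]
      exact pow_le_one₀ (by positivity) inv_mul_le_one
    · simp only [Pi.smul_apply, smul_eq_mul, mul_left_comm _ N⁻¹, integral_const_mul,
        hs.integral_mul_eq, ← hN2]
      rcases eq_or_ne N 0 with h0 | h0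
      · simp [h0]
      · field_simp
  -- By the weak equation `∫ r v = ∫ ∇φ · ∇v`, and Cauchy-Schwarz applies.
  · rintro s ⟨v, gv, hv, h1, rfl⟩
    rw [← hs.weak_eq v gv hv, ← inner_toLp hs.isH1.memLp_grad hv.memLp_grad]
    refine (real_inner_le_norm _ _).trans (mul_le_of_le_one_right (norm_nonneg _) ?_)
    rw [← norm_toLp_sq hv.memLp_grad] at h1
    exact (sq_le_one_iff₀ (norm_nonneg _)).1 h1

end IsNeumannSolution

end PoissonEnergy

/-! ### Assembly of the theorem -/

theorem mainTheorem1 (R : Rect) :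
    -- the Neumann Laplacian has an orthonormal basis of eigenfunctions
    (∃ (lam : ℕ → ℝ) (ψ : HilbertBasis ℕ ℝ (Lp ℝ 2 (volume.restrict R.domain))),
      IsNeumannEigenbasis R.domain lam ψ) ∧
    -- the residual of a floorplan inside the rectangle has zero mean
    (∀ (n : ℕ) (M : Modules n) (c : Fin n → Plane), (∀ i, M.region c i ⊆ R.closedDomain) →
      MemL2Zero R.domain (fun x => M.density c x - M.meanDensity R)) ∧
    -- for all residual densities `r = ρ - ρ̄` of zero mean and all such eigenbases
    ∀ (lam : ℕ → ℝ) (ψ : HilbertBasis ℕ ℝ (Lp ℝ 2 (volume.restrict R.domain))),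
      IsNeumannEigenbasis R.domain lam ψ →
    ∀ (ρ : Plane → ℝ) (ρbar : ℝ) (r : Plane → ℝ), r = (fun x => ρ x - ρbar) →
    ∀ (hr : MemL2Zero R.domain r) (α : ℕ → ℝ),
      (∀ k, α k = ∫ x in R.domain, r x * ψ k x) →
      -- expansion in `L²`, starting from `k = 1`
      (α 0 = 0 ∧ HasSum (fun k : ℕ => α (k + 1) • ψ (k + 1)) (hr.memLp.toLp r)) ∧
      -- variance
      (Summable (fun k : ℕ => α (k + 1) ^ 2) ∧
        variance R.domain ρ ρbar = ∑' k : ℕ, α (k + 1) ^ 2) ∧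
      -- the potential exists and is unique
      (∃ (φ : Plane → ℝ) (g : Plane → Plane), IsNeumannSolution R.domain r φ g) ∧
      (∀ (φ φ' : Plane → ℝ) (g g' : Plane → Plane), IsNeumannSolution R.domain r φ g →
        IsNeumannSolution R.domain r φ' g' → φ =ᵐ[volume.restrict R.domain] φ') ∧
      -- Poisson energy
      Summable (fun k : ℕ => α (k + 1) ^ 2 / lam (k + 1)) ∧
      BddAbove (dualValues R.domain r) ∧
      ∀ (φ : Plane → ℝ) (g : Plane → Plane), IsNeumannSolution R.domain r φ g →
        poissonEnergy R.domain r φ = 1 / 2 * ∑' k : ℕ, α (k + 1) ^ 2 / lam (k + 1) ∧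
        poissonEnergy R.domain r φ = 1 / 2 * ∫ x in R.domain, ‖g x‖ ^ 2 ∧
        0 ≤ poissonEnergy R.domain r φ ∧
        poissonEnergy R.domain r φ = 1 / 2 * hMinusOneNorm R.domain r ^ 2 := by
  refine ⟨R.exists_isNeumannEigenbasis, fun n M c hc => M.memL2Zero_density_sub R c hc, ?_⟩
  intro lam ψ h ρ ρbar r hrρ hr α hα
  have hα' : ∀ k, inner ℝ (ψ k) (hr.memLp.toLp r) = α k := fun k => by
    rw [inner_coe_toLp, hα]
  have hα0 : α 0 = 0 := by rw [← hα', h.inner_zero_eq_zero hr.memLp hr.integral_eq_zero]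
  have hvar := h.hasSum_inner_succ hr hr.memLp
  simp only [hα', ← pow_two] at hvar
  have henergy : ∀ φ g, IsNeumannSolution R.domain r φ g →
      HasSum (fun k : ℕ => α (k + 1) ^ 2 / lam (k + 1)) (∫ x in R.domain, r x * φ x) :=
    fun φ g hs => by
      have := h.hasSum_inner_succ hr hs.isH1.memLp
      simpa only [hs.inner_succ_eq h, hα', ← hα, ← mul_div_assoc, ← pow_two] using this
  -- One solution also gives the convergence of the energy series and the bound on the dual values,
  -- neither of which mentions a potential.
  obtain ⟨φ₀, g₀, hs₀⟩ := h.exists_isNeumannSolution hr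
  refine ⟨⟨hα0, ?_⟩, ⟨hvar.summable, ?_⟩, ⟨φ₀, g₀, hs₀⟩, fun φ φ' g g' hs hs' => hs.ae_eq hs' h,
    (henergy _ _ hs₀).summable, ⟨_, hs₀.isGreatest_dualValues.2⟩, fun φ g hs => ⟨?_, ?_, ?_, ?_⟩⟩
  · have hsum := ψ.hasSum_repr (hr.memLp.toLp r)
    simp only [ψ.repr_apply_apply, hα'] at hsum
    exact hsum.comp_succ_of_eq_zero (by rw [hα0, zero_smul])
  · rw [hvar.tsum_eq, variance, hrρ]
  · rw [poissonEnergy, (henergy φ g hs).tsum_eq]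
  · rw [poissonEnergy, hs.integral_mul_eq]
  · rw [poissonEnergy, hs.integral_mul_eq]
    exact mul_nonneg (by norm_num) (integral_nonneg fun _ => sq_nonneg _)
  · rw [poissonEnergy, hs.integral_mul_eq, hMinusOneNorm, hs.isGreatest_dualValues.csSup_eq,
      norm_toLp_sq]
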